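/- Let $N,s,t\ge 0$ be integers, and let $\alpha=(\alpha_0,\dots,\alpha_N)$, $\beta=(\beta_0,\dots,\beta_N)$ be orthonormal vectors in $\mathbb{C}^{N+1}$, i.e. $\sum_k\alpha_k^*\beta_k=0$ and $\sum_k|\alpha_k|^2=\sum_k|\beta_k|^2=1$. Let $\mathcal{C}$ be the $N$-qubit permutation-invariant code spanned by $|0_L\rangle=\sum_{k=0}^N\alpha_k|D^N_k\rangle$ and $|1_L\rangle=\sum_{k=0}^N\beta_k|D^N_k\rangle$, where $|D^N_k\rangle=\binom Nk^{-1/2}\sum_{x\in\{0,1\}^N,\,|x|=k}|x\rangle$ are the Dicke states. The $t$-insertion channel is $$\mathcal{I}_{t,p}(\rho)=\sum_{\vec a}\int p(\vec a,v)\,\pi_{\vec a}\big(|\phi_v\rangle\langle\phi_v|\otimes\rho\big)\pi_{\vec a}^\dagger\,d\mu(v).$$ Here $\vec a=(a_0,\dots,a_N)$ runs over the tuples of nonnegative integers with sum $t$; $v$ runs over the unit sphere of $\mathbb{C}^{\{0,1\}^t}$, with $|\phi_v\rangle=\sum_x v_x|x\rangle$; $\pi_{\vec a}$ is the permutation of the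 $N+t$ qubits that places $a_i$ of the $t$ inserted qubits after exactly $i$ of the $N$ original qubits, keeping the order within the inserted and within the original qubits; $\mu$ is a Borel measure on the sphere that is positive on nonempty open sets; and $p(\vec a,\cdot)$ is everywhere positive and $\mu$-integrable, with $\sum_{\vec a}\int p(\vec a,v)\,d\mu(v)=1$. The $s$-deletion channel on $N+t$ qubits is $\mathcal{D}_{s,q}(\rho)=\sum_d q(d)\,\mathrm{tr}_d(\rho)$, where $d$ runs over the $s$-element subsets of $\{1,\dots,N+t\}$, $q(d)>0$ and $\sum_d q(d)=1$ (so $s\le N+t$). Then, for any given such $\mu,p,q$, the code $\mathcal{C}$ is correctable against $\mathcal{D}_{s,q}\circ\mathcal{I}_{t,p}$ ($t$ insertions followed by $s$ deletions), i.e. there is a quantum channel $\mathcal{R}$ with $\mathcal{R}\big(\mathcal{D}_{s,q}(\mathcal{I}_{t,p}(|\psi\rangle\langle\psi|))\big)=|\psi\rangle\langle\psi|$ for every unit vector $|\psi\rangle\in\mathcal{C}$, if and only if for all integers $0\le\ell\le\min(s,t)$, $0\le j\le t-\ell$ and $0\le a',b'\le t+s-2\ell-j$, $$\text{(C5)}\quad\sum_{k=0}^N\frac{\binom{N-t-s+2\ell+j}{k}}{\sqrt{\binom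 N{k+a'}\binom N{k+b'}}}\,\alpha_{k+a'}^*\beta_{k+b'}=0,$$ $$\text{(C6)}\quad\sum_{k=0}^N\frac{\binom{N-t-s+2\ell+j}{k}}{\sqrt{\binom N{k+a'}\binom N{k+b'}}}\big(\alpha_{k+a'}^*\alpha_{k+b'}-\beta_{k+a'}^*\beta_{k+b'}\big)=0.$$ Here $\binom nk=0$ if $n<0$, and terms in which $k+a'>N$ or $k+b'>N$ are zero. -/

import Mathlib

open MeasureTheory
open scoped Kronecker

noncomputable section

namespace Insdel

/-- Computational basis labels `x ∈ {0,1}ⁿ` of an `n`-qubit register. -/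
abbrev Bits (n : ℕ) : Type := Fin n → Fin 2

/-- Operators on an `n`-qubit register, as matrices in the computational basis. -/
abbrev Op (n : ℕ) : Type := Matrix (Bits n) (Bits n) ℂ

/-- Hamming weight. -/
def weight {n : ℕ} (x : Bits n) : ℕ := ∑ i, (x i : ℕ)

/-- The Dicke state `|D^N_k⟩`. -/
def dicke (N k : ℕ) : Bits N → ℂ :=
  fun x => if weight x = k then 1 / ((Real.sqrt (N.choose k) : ℝ) : ℂ) else 0

/-- The permutation-invariant codeword `∑ₖ γₖ |D^N_k⟩`. -/
def codeword {N : ℕ} (γ : Fin (N + 1) → ℂ) : Bits N → ℂ :=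
  ∑ k : Fin (N + 1), γ k • dicke N k

/-- The permutation-invariant code spanned by `|0_L⟩` and `|1_L⟩`. -/
def piCode {N : ℕ} (α β : Fin (N + 1) → ℂ) : Submodule ℂ (Bits N → ℂ) :=
  Submodule.span ℂ {codeword α, codeword β}

/-- The rank-one operator `|ψ⟩⟨ψ|`. -/
def pureState {n : ℕ} (ψ : Bits n → ℂ) : Op n := Matrix.vecMulVec ψ (star ψ)

/-- Quantum channels, in operator-sum (Kraus) form. -/
def IsQuantumChannel {m n : ℕ} (R : Op m → Op n) : Prop :=
  ∃ (r : ℕ) (K : Fin r → Matrix (Bits n) (Bits m) ℂ),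
    ∑ i, (K i).conjTranspose * K i = 1 ∧
      ∀ M : Op m, R M = ∑ i, K i * M * (K i).conjTranspose

/-- The code `C` is correctable against the noise `E`: one recovery channel restores every
normalized code state. -/
def IsCorrectable {N n : ℕ} (C : Submodule ℂ (Bits N → ℂ)) (E : Op N → Op n) : Prop :=
  ∃ R : Op n → Op N, IsQuantumChannel R ∧
    ∀ ψ ∈ C, ∑ x, ‖ψ x‖ ^ 2 = 1 → R (E (pureState ψ)) = pureState ψ

/-- Given a placement of `m + n` qubits on `k` sites, the induced relabelling of the tensor
product basis of an `m`-qubit and an `n`-qubit register. -/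
def placeBits {m n k : ℕ} (e : Fin m ⊕ Fin n ≃ Fin k) : Bits m × Bits n ≃ Bits k :=
  (Equiv.sumArrowEquivProdArrow (Fin m) (Fin n) (Fin 2)).symm.trans
    (Equiv.arrowCongr e (Equiv.refl (Fin 2)))

/-! ### Insertions -/

/-- Insertion structures `(a₀, …, a_N)`: `aᵢ` qubits are inserted in position `i`, that is, after
exactly `i` of the `N` original qubits. -/
abbrev InsertionStructure (N t : ℕ) : Type := {a : Fin (N + 1) → ℕ // ∑ i, a i = t}

instance (N t : ℕ) : Fintype (InsertionStructure N t) :=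
  Fintype.subtype (Finset.Nat.antidiagonalTuple (N + 1) t)
    (fun _ => Finset.Nat.mem_antidiagonalTuple)

/-- The site of the original qubit `k` (counted from `0`) after the insertion: it is preceded by
`k` original qubits and by the qubits inserted in positions `0, …, k`. -/
def originalSite {N t : ℕ} (a : InsertionStructure N t) (k : Fin N) : Fin (N + t) :=
  ⟨k + ∑ i ∈ Finset.Iic k.castSucc, a.1 i, by
    have h : ∑ i ∈ Finset.Iic k.castSucc, a.1 i ≤ ∑ i, a.1 i :=
      Finset.sum_le_sum_of_subset (Finset.subset_univ _)
    have := a.2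
    have := k.2
    omega⟩

theorem originalSite_injective {N t : ℕ} (a : InsertionStructure N t) :
    Function.Injective (originalSite a) := by
  have h : StrictMono (originalSite a) := by
    intro k l hkl
    have h1 : ∑ i ∈ Finset.Iic k.castSucc, a.1 i ≤ ∑ i ∈ Finset.Iic l.castSucc, a.1 i :=
      Finset.sum_le_sum_of_subset (Finset.Iic_subset_Iic.2 (by simpa using hkl.le))
    have h2 : (k : ℕ) < l := hkl
    change (k : ℕ) + _ < (l : ℕ) + _
    omega
  exact h.injective

/-- The sites of the inserted qubits. -/
def insertedSites {N t : ℕ} (a : InsertionStructure N t) : Finset (Fin (N + t)) :=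
  (Finset.univ.image (originalSite a))ᶜ

theorem card_insertedSites {N t : ℕ} (a : InsertionStructure N t) :
    (insertedSites a).card = t := by
  simp [insertedSites, Finset.card_compl,
    Finset.card_image_of_injective _ (originalSite_injective a)]

theorem card_insertedSites_compl {N t : ℕ} (a : InsertionStructure N t) :
    (insertedSites a)ᶜ.card = N := by
  simp [insertedSites, Finset.card_image_of_injective _ (originalSite_injective a)]

/-- The permutation `π_a`: the `t` inserted qubits and the `N` original qubits go, each group in
its own order, to the sites prescribed by `a`. -/
def insertionEquiv {N t : ℕ} (a : InsertionStructure N t) : Fin t ⊕ Fin N ≃ Fin (N + t) :=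
  finSumEquivOfFinset (card_insertedSites a) (card_insertedSites_compl a)

/-- Insertion of the `t`-qubit operator `σ`: `π_a (σ ⊗ ρ) π_a†`. -/
def insertAt {N t : ℕ} (a : InsertionStructure N t) (σ : Op t) (ρ : Op N) : Op (N + t) :=
  Matrix.reindex (placeBits (insertionEquiv a)) (placeBits (insertionEquiv a)) (σ ⊗ₖ ρ)

/-- Normalized insertion coefficients `(v_x)`, `x ∈ {0,1}ᵗ`. -/
abbrev InsertionCoeff (t : ℕ) : Type :=
  Metric.sphere (0 : EuclideanSpace ℂ (Bits t)) 1

/-- The `t`-insertion channel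
`ρ ↦ ∑ₐ ∫ p(a,v) π_a (|φ_v⟩⟨φ_v| ⊗ ρ) π_a† dμ(v)`; the integral is taken entrywise. -/
def insertionChannel {N t : ℕ} (μ : Measure (InsertionCoeff t))
    (p : InsertionStructure N t → InsertionCoeff t → ℝ) (ρ : Op N) : Op (N + t) :=
  ∑ a, Matrix.of fun x y =>
    ∫ v, (p a v : ℂ) * insertAt a (pureState fun z => v.1 z) ρ x y ∂μ

/-! ### Deletions -/

/-- Deletion sets: the `s`-element subsets of the `m` sites. -/
abbrev DeletionSet (m s : ℕ) : Type := {d : Finset (Fin m) // d.card = s}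

theorem card_deletionSet_compl {m s : ℕ} (d : DeletionSet m s) : d.1ᶜ.card = m - s := by
  simp [Finset.card_compl, d.2]

/-- The deleted and the remaining sites, each group listed in increasing order. -/
def deletionEquiv {m s : ℕ} (d : DeletionSet m s) : Fin s ⊕ Fin (m - s) ≃ Fin m :=
  finSumEquivOfFinset d.2 (card_deletionSet_compl d)

/-- Partial trace over the qubits in `d`; the remaining qubits keep their order. -/
def partialTrace {m s : ℕ} (d : DeletionSet m s) (ρ : Op m) : Op (m - s) :=
  Matrix.of fun x y =>
    ∑ z : Bits s, ρ (placeBits (deletionEquiv d) (z, x)) (placeBits (deletionEquiv d) (z, y))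

/-- The `s`-deletion channel `ρ ↦ ∑_d q(d) tr_d ρ`. -/
def deletionChannel {m s : ℕ} (q : DeletionSet m s → ℝ) (ρ : Op m) : Op (m - s) :=
  ∑ d, (q d : ℂ) • partialTrace d ρ

/-! ### Coefficients in the conditions -/

/-- Binomial coefficient with an integer upper entry; zero if the upper entry is negative. -/
def binom (n : ℤ) (k : ℕ) : ℕ := if 0 ≤ n then n.toNat.choose k else 0

/-- `γₖ`, read as zero for `k > N`. -/
def coeff {N : ℕ} (γ : Fin (N + 1) → ℂ) (k : ℕ) : ℂ :=
  if h : k < N + 1 then γ ⟨k, h⟩ else 0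

/-- The weight `C(n,k) / √(C(N,k+a) C(N,k+b))`. -/
def condWeight (N : ℕ) (n : ℤ) (k a b : ℕ) : ℂ :=
  (binom n k : ℂ) / ((Real.sqrt ((N.choose (k + a) : ℝ) * (N.choose (k + b) : ℝ)) : ℝ) : ℂ)

end Insdel

end

/-! Expanding `|φ_v⟩⟨φ_v|` in the computational basis turns the noise into `∑ c k l • A k ρ (A l)ᴴ`,
where the operator `A` with index `(a, d, z, x)` inserts `|x⟩` according to `a` and projects the
sites in `d` onto `|z⟩`. The measure and the probabilities enter only through `c`, which is block
diagonal with blocks `q d` times the moment matrix of `p a`. The blocks are positive definite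
because `p > 0` and `μ` charges open sets. Hence correctability is the Knill–Laflamme condition for
the operators `A` (`isCorrectable_iff_scalar_gram`), from which `μ`, `p`, `q` have disappeared.

Codeword amplitudes depend on the Hamming weight alone. In a Gram entry the inserted bits fix the
remaining bits, except on the `r` remaining sites that are original for both insertions. Unless the
constraints clash and the entry is zero, it equals `∑ₖ C(r,k) H(a+k, b+k)` with `a, b ≤ N - r`
(`overlap_eq_binomialSum`). At most `2t` of the `N + t - s` remaining sites are fixed, so `r ≥ N - s
- t`.

Conversely, the least `r` occurs with all admissible `a, b` (`exists_overlap_eq_binomialSum`), and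
Pascal's rule carries vanishing from there to every larger `r` (`binomialSum_eq_zero_of_le`).
Conditions (C5) and (C6) are these vanishing statements with `r = N - t - s + 2ℓ + j`
(`forall_insdel_index_iff`). -/

noncomputable section

namespace Insdel

open Matrix
open scoped ComplexOrder

/-! ### Knill–Laflamme conditions for a two-dimensional code -/

section KnillLaflamme

variable {m n : ℕ}

theorem isQuantumChannel_of_fintype {ι : Type*} [Fintype ι] (R : Op m → Op n)
    (K : ι → Matrix (Bits n) (Bits m) ℂ) (hK : ∑ i, (K i)ᴴ * K i = 1)
    (hR : ∀ M, R M = ∑ i, K i * M * (K i)ᴴ) : IsQuantumChannel R := by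
  let e := Fintype.equivFin ι
  refine ⟨Fintype.card ι, fun i => K (e.symm i), ?_, fun M => ?_⟩
  · rw [← hK]
    exact e.symm.sum_comp (fun i => (K i)ᴴ * K i)
  · rw [hR]
    exact (e.symm.sum_comp (fun i => K i * M * (K i)ᴴ)).symm

theorem mul_pureState_mul_conjTranspose {Y Z : Type*} (A : Matrix Y (Bits n) ℂ)
    (B : Matrix Z (Bits n) ℂ) (ψ : Bits n → ℂ) :
    A * pureState ψ * Bᴴ = vecMulVec (A *ᵥ ψ) (star (B *ᵥ ψ)) := by
  rw [pureState, mul_vecMulVec, vecMulVec_mul, star_mulVec]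

theorem star_dotProduct_vecMulVec_mulVec {Y : Type*} [Fintype Y] (φ u w : Y → ℂ) :
    star φ ⬝ᵥ (vecMulVec u (star w) *ᵥ φ) = (star φ ⬝ᵥ u) * star (star φ ⬝ᵥ w) := by
  rw [vecMulVec_mulVec, op_smul_eq_smul, dotProduct_smul, smul_eq_mul, mul_comm, star_dotProduct w]

theorem trace_pureState (ψ : Bits n → ℂ) : (pureState ψ).trace = ψ ⬝ᵥ star ψ := by
  rw [pureState, trace_vecMulVec]

/-- Matrices whose mutual Gram products are scalar admit an orthonormal frame of their span. -/
theorem exists_frame_of_scalar_gram {Y J : Type*} [Fintype Y] [Fintype J]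
    (B : J → Matrix Y (Fin 2) ℂ) (Λ : J → J → ℂ)
    (hΛ : ∀ i j, (B i)ᴴ * B j = Λ i j • (1 : Matrix (Fin 2) (Fin 2) ℂ)) :
    ∃ (r : ℕ) (W : Fin r → Matrix Y (Fin 2) ℂ),
      (∀ k l, (W k)ᴴ * W l = if k = l then 1 else 0) ∧
      ∀ j, ∃ s : Fin r → ℂ, B j = ∑ k, s k • W k := by
  classical
  let D : (J → ℂ) →ₗ[ℂ] Matrix Y (Fin 2) ℂ := Fintype.linearCombination ℂ B
  have hD : ∀ g, D g = ∑ j, g j • B j := fun g => Fintype.linearCombination_apply ℂ B g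
  have hgram : ∀ g h, (D g)ᴴ * D h =
      (∑ i, ∑ j, star (g i) * h j * Λ i j) • (1 : Matrix (Fin 2) (Fin 2) ℂ) := by
    intro g h
    simp only [hD, conjTranspose_sum, conjTranspose_smul, Finset.sum_smul]
    rw [Matrix.sum_mul]
    simp only [Matrix.mul_sum]
    refine Finset.sum_congr rfl fun i _ => Finset.sum_congr rfl fun j _ => ?_
    rw [Matrix.smul_mul, Matrix.mul_smul, hΛ, smul_smul, smul_smul]
  have hgram' : ∀ g h, (D g)ᴴ * D h = ((D g)ᴴ * D h) 0 0 • (1 : Matrix (Fin 2) (Fin 2) ℂ) := by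
    intro g h
    rw [hgram]
    simp
  -- The scalar in a Gram matrix is the squared norm of the first column, so the first column
  -- determines the whole combination. An orthonormal basis of the first columns therefore lifts to
  -- the frame.
  have hzero : ∀ g, (∀ y, D g y 0 = 0) → D g = 0 := by
    intro g hg
    apply conjTranspose_mul_self_eq_zero.1
    rw [hgram', Matrix.mul_apply]
    simp [hg]
  let col : Matrix Y (Fin 2) ℂ →ₗ[ℂ] EuclideanSpace ℂ Y :=
    { toFun := fun M => WithLp.toLp 2 fun y => M y 0
      map_add' := fun _ _ => rfl
      map_smul' := fun _ _ => rfl }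
  have hinner : ∀ g h, inner ℂ (col (D g)) (col (D h)) = ((D g)ᴴ * D h) 0 0 := by
    intro g h
    rw [EuclideanSpace.inner_eq_star_dotProduct, Matrix.mul_apply, dotProduct]
    refine Finset.sum_congr rfl fun y _ => ?_
    exact mul_comm _ _
  let V := LinearMap.range (col ∘ₗ D)
  let b := stdOrthonormalBasis ℂ V
  have hb : ∀ k, ∃ g, col (D g) = (b k : EuclideanSpace ℂ Y) := fun k => (b k).2
  choose g hg using hb
  refine ⟨_, fun k => D (g k), fun k l => ?_, fun j => ?_⟩
  · rw [hgram', ← hinner, hg, hg, ← Submodule.coe_inner, orthonormal_iff_ite.1 b.orthonormal]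
    split_ifs <;> simp
  · have hj : B j = D (Pi.single j 1) := by
      rw [hD, Finset.sum_eq_single j] <;> simp +contextual
    let v : V := ⟨col (D (Pi.single j 1)), ⟨Pi.single j 1, rfl⟩⟩
    refine ⟨fun k => b.repr v k, ?_⟩
    rw [hj, ← sub_eq_zero]
    have hlin : D (Pi.single j 1) - ∑ k, b.repr v k • D (g k) =
        D (Pi.single j 1 - ∑ k, b.repr v k • g k) := by
      simp [map_sub, map_sum]
    rw [hlin]
    apply hzero
    intro y
    have hv := congrArg (Subtype.val) (b.sum_repr v)
    rw [← hlin]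
    have h0 : col (D (Pi.single j 1) - ∑ k, b.repr v k • D (g k)) = 0 := by
      rw [map_sub, map_sum, sub_eq_zero]
      simp only [map_smul, hg]
      rw [show col (D (Pi.single j 1)) = (v : EuclideanSpace ℂ Y) from rfl, ← hv]
      simp
    exact congrFun (congrArg WithLp.ofLp h0) y

/-- Sufficiency of the Knill–Laflamme conditions. -/
theorem isCorrectable_of_scalar_gram {J : Type*} [Fintype J] (C : Matrix (Bits m) (Fin 2) ℂ)
    (hC : Cᴴ * C = 1) (A : J → Matrix (Bits n) (Bits m) ℂ) (c : J → J → ℂ) (E : Op m → Op n)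
    (hE : ∀ ψ, E (pureState ψ) = ∑ i, ∑ j, c i j • (A i * pureState ψ * (A j)ᴴ))
    (htr : ∀ ψ, (pureState ψ).trace = 1 → (E (pureState ψ)).trace = 1)
    (h : ∀ i j, ∃ l : ℂ, (A i * C)ᴴ * (A j * C) = l • (1 : Matrix (Fin 2) (Fin 2) ℂ)) :
    IsCorrectable (LinearMap.range C.mulVecLin) E := by
  classical
  choose Λ hΛ using h
  obtain ⟨r, W, hW, hs⟩ := exists_frame_of_scalar_gram (fun j => A j * C) Λ hΛ
  choose s hs using hs
  set P : Op n := ∑ k, W k * (W k)ᴴ with hP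
  have hPW : ∀ k, P * W k = W k := by
    intro k
    rw [hP, Matrix.sum_mul, Finset.sum_eq_single k]
    · rw [Matrix.mul_assoc, hW, if_pos rfl, Matrix.mul_one]
    · intro l _ hl
      rw [Matrix.mul_assoc, hW, if_neg hl, Matrix.mul_zero]
    · simp
  have hPP : P * P = P := by
    conv_lhs => rw [hP, Matrix.mul_sum]
    refine Finset.sum_congr rfl fun k _ => ?_
    rw [← Matrix.mul_assoc, hPW]
  have hPH : Pᴴ = P := by
    simp [hP, conjTranspose_sum]
  set Q : Op n := 1 - P with hQ
  have hQH : Qᴴ = Q := by simp [hQ, hPH]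
  have hQQ : Q * Q = Q := by
    rw [hQ]; simp [Matrix.mul_sub, Matrix.sub_mul, hPP]
  have hQW : ∀ k, Q * W k = 0 := by
    intro k; rw [hQ, Matrix.sub_mul, hPW]; simp
  let v0 : Bits m → ℂ := fun x => C x 0
  have hv0 : star v0 ⬝ᵥ v0 = 1 := by
    have := congrFun (congrFun hC 0) 0
    simpa [Matrix.mul_apply, dotProduct, v0] using this
  -- Off the range of `P` the recovery only has to preserve the trace; it resets every basis state
  -- to the first column of `C`.
  let F : Bits n → Matrix (Bits m) (Bits n) ℂ := fun y => vecMulVec v0 (Pi.single y 1)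
  let K : Fin r ⊕ Bits n → Matrix (Bits m) (Bits n) ℂ :=
    Sum.elim (fun k => C * (W k)ᴴ) (fun y => F y * Q)
  have hF : ∀ y, (F y)ᴴ * F y = Matrix.single y y 1 := by
    intro y
    simp only [F, conjTranspose_vecMulVec, vecMulVec_mul_vecMulVec]
    rw [hv0]
    ext i j
    by_cases h1 : y = i <;> by_cases h2 : y = j <;>
      simp [vecMulVec_apply, Matrix.single_apply, Pi.single_apply, eq_comm, h1, h2]
  have hK : ∑ i, (K i)ᴴ * K i = 1 := by
    rw [Fintype.sum_sum_type]
    have h1 : ∀ k, (K (Sum.inl k))ᴴ * K (Sum.inl k) = W k * (W k)ᴴ := by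
      intro k
      simp only [K, Sum.elim_inl, conjTranspose_mul, conjTranspose_conjTranspose]
      rw [Matrix.mul_assoc, ← Matrix.mul_assoc Cᴴ, hC, Matrix.one_mul]
    have h2 : ∀ y, (K (Sum.inr y))ᴴ * K (Sum.inr y) = Q * Matrix.single y y 1 * Q := by
      intro y
      simp only [K, Sum.elim_inr, conjTranspose_mul, hQH]
      rw [Matrix.mul_assoc, ← Matrix.mul_assoc (F y)ᴴ, hF, Matrix.mul_assoc]
    simp only [h1, h2]
    rw [← Matrix.sum_mul, ← Matrix.mul_sum, Matrix.sum_single_one, Matrix.mul_one, hQQ, ← hP, hQ]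
    abel
  refine ⟨fun M => ∑ i, K i * M * (K i)ᴴ, isQuantumChannel_of_fintype _ K hK fun _ => rfl, ?_⟩
  rintro _ ⟨a, rfl⟩ hψ
  set ψ := C.mulVecLin a with hψdef
  have hψC : ψ = C *ᵥ a := rfl
  have hψtr : (pureState ψ).trace = 1 := by
    rw [trace_pureState, dotProduct]
    have : ∀ x, ψ x * (star ψ) x = ((‖ψ x‖ ^ 2 : ℝ) : ℂ) := fun x => by
      simp [Complex.mul_conj, Complex.normSq_eq_norm_sq]
    simp only [this]
    rw [← Complex.ofReal_sum, hψ, Complex.ofReal_one]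
  have hKl : ∀ k j, K (Sum.inl k) * A j * C = s j k • C := by
    intro k j
    rw [Matrix.mul_assoc, hs, Matrix.mul_sum, Finset.sum_eq_single k]
    · simp only [K, Sum.elim_inl]
      rw [Matrix.mul_smul, Matrix.mul_assoc, hW, if_pos rfl, Matrix.mul_one]
    · intro l _ hl
      simp only [K, Sum.elim_inl]
      rw [Matrix.mul_smul, Matrix.mul_assoc, hW, if_neg (Ne.symm hl), Matrix.mul_zero, smul_zero]
    · simp
  have hKr : ∀ y j, K (Sum.inr y) * A j * C = 0 := by
    intro y j
    rw [Matrix.mul_assoc, hs, Matrix.mul_sum]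
    refine Finset.sum_eq_zero fun k _ => ?_
    simp only [K, Sum.elim_inr]
    rw [Matrix.mul_smul, Matrix.mul_assoc, hQW, Matrix.mul_zero, smul_zero]
  have hKψ : ∀ i, ∃ w : J → ℂ, ∀ j, (K i * A j) *ᵥ ψ = w j • ψ := by
    rintro (k | y)
    · refine ⟨fun j => s j k, fun j => ?_⟩
      rw [hψC, mulVec_mulVec, hKl, smul_mulVec]
    · refine ⟨fun j => 0, fun j => ?_⟩
      rw [hψC, mulVec_mulVec, hKr, zero_mulVec, zero_smul]
  choose w hw using hKψ
  -- Only proportionality is needed here: trace preservation forces the factor to be one.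
  have hscal : ∃ l : ℂ, ∑ i, K i * E (pureState ψ) * (K i)ᴴ = l • pureState ψ := by
    refine ⟨∑ i, ∑ j, ∑ j', c j j' * (w i j * star (w i j')), ?_⟩
    simp only [hE, Matrix.mul_sum, Matrix.sum_mul, Finset.sum_smul]
    refine Finset.sum_congr rfl fun i _ => Finset.sum_congr rfl fun j _ =>
      Finset.sum_congr rfl fun j' _ => ?_
    have : K i * (A j * pureState ψ * (A j')ᴴ) * (K i)ᴴ =
        (K i * A j) * pureState ψ * (K i * A j')ᴴ := by
      simp only [conjTranspose_mul, Matrix.mul_assoc]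
    rw [Matrix.mul_smul, Matrix.smul_mul, this, mul_pureState_mul_conjTranspose, hw, hw,
      ← smul_smul, pureState]
    congr 1
    ext x y
    simp [vecMulVec_apply]
    ring
  obtain ⟨l, hl⟩ := hscal
  have htrR : (∑ i, K i * E (pureState ψ) * (K i)ᴴ).trace = 1 := by
    rw [trace_sum]
    have : ∀ i, (K i * E (pureState ψ) * (K i)ᴴ).trace = ((K i)ᴴ * K i * E (pureState ψ)).trace := by
      intro i
      rw [trace_mul_comm, Matrix.mul_assoc]
    simp only [this]
    rw [← trace_sum, ← Matrix.sum_mul, hK, Matrix.one_mul, htr ψ hψtr]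
  show ∑ i, K i * E (pureState ψ) * (K i)ᴴ = pureState ψ
  rw [hl] at htrR ⊢
  rw [trace_smul, hψtr, smul_eq_mul, mul_one] at htrR
  rw [htrR, one_smul]

/-- Comparing the factors at `e₀`, `e₁` and `e₀ + e₁` forces them to agree, as for a linear map of
which every vector is an eigenvector. -/
theorem exists_eq_smul_one_of_forall_mulVec {Z : Type*} (S : Matrix Z (Fin 2) ℂ)
    (C : Matrix Z (Fin 2) ℂ) (hC : ∀ a, C *ᵥ a = 0 → a = 0)
    (h : ∀ a, ∃ l : ℂ, S *ᵥ a = l • (C *ᵥ a)) : ∃ l : ℂ, S = l • C := by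
  obtain ⟨l0, h0⟩ := h ![1, 0]
  obtain ⟨l1, h1⟩ := h ![0, 1]
  obtain ⟨l2, h2⟩ := h ![1, 1]
  have hz : C *ᵥ ![l0 - l2, l1 - l2] = 0 := by
    ext x
    have e0 := congrFun h0 x
    have e1 := congrFun h1 x
    have e2 := congrFun h2 x
    simp [mulVec, dotProduct, Fin.sum_univ_two] at e0 e1 e2 ⊢
    linear_combination e2 - e0 - e1
  have hz' := hC _ hz
  have e0 : l0 = l2 := sub_eq_zero.1 (by simpa using congrFun hz' 0)
  have e1 : l1 = l2 := sub_eq_zero.1 (by simpa using congrFun hz' 1)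
  refine ⟨l2, ?_⟩
  ext x i
  have f0 := congrFun h0 x
  have f1 := congrFun h1 x
  simp [mulVec, dotProduct, Fin.sum_univ_two] at f0 f1
  fin_cases i
  · simpa [e0] using f0
  · simpa [e1] using f1

/-- Necessity of the Knill–Laflamme conditions, for noise given by a positive definite matrix of
coefficients with respect to the operators `A`. -/
theorem scalar_gram_of_isCorrectable {J : Type*} [Fintype J] (C : Matrix (Bits m) (Fin 2) ℂ)
    (hC : Cᴴ * C = 1) (A : J → Matrix (Bits n) (Bits m) ℂ) (c : Matrix J J ℂ) (hc : c.PosDef)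
    (E : Op m → Op n)
    (hE : ∀ ψ, E (pureState ψ) = ∑ i, ∑ j, c i j • (A i * pureState ψ * (A j)ᴴ))
    (h : IsCorrectable (LinearMap.range C.mulVecLin) E) (i j : J) :
    ∃ l : ℂ, (A i * C)ᴴ * (A j * C) = l • (1 : Matrix (Fin 2) (Fin 2) ℂ) := by
  classical
  obtain ⟨R, ⟨r, K, hK, hR⟩, hcorr⟩ := h
  have hCinj : ∀ a, C *ᵥ a = 0 → a = 0 := by
    intro a ha
    have : (Cᴴ * C) *ᵥ a = 0 := by rw [← mulVec_mulVec, ha, mulVec_zero]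
    simpa [hC] using this
  -- For `φ ⟂ ψ` the number `⟨φ|R(E(ψ))|φ⟩ = 0` is a sum over `k` of values of the quadratic form of
  -- `c`. Each is nonnegative, hence zero, and definiteness kills its argument.
  have key : ∀ a : Fin 2 → ℂ, ∑ x, ‖(C *ᵥ a) x‖ ^ 2 = 1 → ∀ φ : Bits m → ℂ,
      star φ ⬝ᵥ (C *ᵥ a) = 0 → ∀ k i, star φ ⬝ᵥ ((K k * A i) *ᵥ (C *ᵥ a)) = 0 := by
    intro a ha φ hφ k i
    set ψ := C *ᵥ a with hψ
    have h1 : ∑ k, K k * E (pureState ψ) * (K k)ᴴ = pureState ψ := by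
      rw [← hR]
      exact hcorr ψ ⟨a, rfl⟩ ha
    let g : Fin r → J → ℂ := fun k i => star φ ⬝ᵥ ((K k * A i) *ᵥ ψ)
    have h2 : ∑ k, star (star (g k)) ⬝ᵥ (c *ᵥ star (g k)) = 0 := by
      have h3 : star φ ⬝ᵥ (pureState ψ *ᵥ φ) = 0 := by
        rw [pureState, star_dotProduct_vecMulVec_mulVec, hφ, zero_mul]
      rw [← h1, sum_mulVec, dotProduct_sum] at h3
      rw [← h3]
      refine Finset.sum_congr rfl fun k _ => ?_
      simp only [hE, Matrix.mul_sum, Matrix.sum_mul, sum_mulVec, dotProduct_sum]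
      have hquad : ∀ x : J → ℂ, star x ⬝ᵥ (c *ᵥ x) = ∑ i, ∑ j, star (x i) * (c i j * x j) :=
        fun x => by simp only [dotProduct, mulVec, Finset.mul_sum, Pi.star_apply]
      rw [hquad]
      refine Finset.sum_congr rfl fun i _ => Finset.sum_congr rfl fun j _ => ?_
      have : K k * (A i * pureState ψ * (A j)ᴴ) * (K k)ᴴ =
          (K k * A i) * pureState ψ * (K k * A j)ᴴ := by
        simp only [conjTranspose_mul, Matrix.mul_assoc]
      rw [Matrix.mul_smul, Matrix.smul_mul, this, mul_pureState_mul_conjTranspose]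
      rw [smul_mulVec, dotProduct_smul, star_dotProduct_vecMulVec_mulVec]
      simp [g]
      ring
    have h4 := (Finset.sum_eq_zero_iff_of_nonneg fun k _ =>
      hc.posSemidef.dotProduct_mulVec_nonneg (star (g k))).1 h2 k (Finset.mem_univ _)
    by_contra hne
    have : star (g k) ≠ 0 := by
      intro h0
      apply hne
      have := congrFun h0 i
      simpa [g] using this
    exact absurd h4 (hc.dotProduct_mulVec_pos this).ne'
  have hspan : ∀ a : Fin 2 → ℂ, ∑ x, ‖(C *ᵥ a) x‖ ^ 2 = 1 → ∀ k i, ∃ l : ℂ,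
      (K k * A i) *ᵥ (C *ᵥ a) = l • (C *ᵥ a) := by
    intro a ha k i
    set ψ := C *ᵥ a with hψ
    set w := (K k * A i) *ᵥ ψ with hw
    have hψψ : star ψ ⬝ᵥ ψ = 1 := by
      rw [dotProduct]
      have : ∀ x, (star ψ) x * ψ x = ((‖ψ x‖ ^ 2 : ℝ) : ℂ) := fun x => by
        simp [mul_comm, Complex.mul_conj, Complex.normSq_eq_norm_sq]
      simp only [this]
      rw [← Complex.ofReal_sum, ha, Complex.ofReal_one]
    -- The residual `w - l • ψ` is orthogonal to `ψ`; used as the test vector in `key`, it turns out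
    -- orthogonal to itself.
    set l := star ψ ⬝ᵥ w with hl
    refine ⟨l, ?_⟩
    have e1 : star ψ ⬝ᵥ (w - l • ψ) = 0 := by
      rw [dotProduct_sub, dotProduct_smul, hψψ, ← hl]; simp
    have e2 : star (w - l • ψ) ⬝ᵥ ψ = 0 := by
      rw [star_dotProduct, e1, star_zero]
    have e3 := key a ha (w - l • ψ) e2 k i
    rw [← hψ, ← hw] at e3
    have e4 : star (w - l • ψ) ⬝ᵥ (w - l • ψ) = 0 := by
      rw [dotProduct_sub, e3, dotProduct_smul, e2]; simp
    exact sub_eq_zero.1 (dotProduct_star_self_eq_zero.1 e4)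
  have hall : ∀ k i, ∃ l : ℂ, K k * (A i * C) = l • C := by
    intro k i
    apply exists_eq_smul_one_of_forall_mulVec _ _ hCinj
    intro a
    by_cases ha : a = 0
    · exact ⟨0, by simp [ha]⟩
    set q : ℝ := ∑ x, ‖(C *ᵥ a) x‖ ^ 2 with hq
    have hq0 : 0 < q := by
      obtain ⟨x, hx⟩ : ∃ x, (C *ᵥ a) x ≠ 0 := by
        by_contra! hcon
        exact ha (hCinj a (funext hcon))
      exact Finset.sum_pos' (fun _ _ => by positivity) ⟨x, Finset.mem_univ _, by positivity⟩
    have hsq : Real.sqrt q ≠ 0 := (Real.sqrt_pos.2 hq0).ne'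
    obtain ⟨l, hl⟩ := hspan (((Real.sqrt q)⁻¹ : ℂ) • a) (by
      simp only [mulVec_smul, Pi.smul_apply, norm_smul, mul_pow]
      rw [← Finset.mul_sum, ← hq, ← Complex.ofReal_inv, Complex.norm_real, Real.norm_eq_abs,
        sq_abs, inv_pow, Real.sq_sqrt hq0.le, inv_mul_cancel₀ hq0.ne']) k i
    refine ⟨l, ?_⟩
    have hne : ((Real.sqrt q)⁻¹ : ℂ) ≠ 0 := inv_ne_zero (Complex.ofReal_ne_zero.2 hsq)
    rw [mulVec_smul, mulVec_smul, smul_comm l] at hl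
    have := smul_right_injective _ hne hl
    rw [← mulVec_mulVec, ← mulVec_mulVec, mulVec_mulVec]
    exact this
  choose l hl using hall
  refine ⟨∑ k, star (l k i) * l k j, ?_⟩
  calc (A i * C)ᴴ * (A j * C)
      = (A i * C)ᴴ * ((∑ k, (K k)ᴴ * K k) * (A j * C)) := by rw [hK, Matrix.one_mul]
    _ = ∑ k, (K k * (A i * C))ᴴ * (K k * (A j * C)) := by
        rw [Matrix.sum_mul, Matrix.mul_sum]
        refine Finset.sum_congr rfl fun k _ => ?_
        rw [conjTranspose_mul (K k), Matrix.mul_assoc, Matrix.mul_assoc]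
    _ = _ := by
        rw [Finset.sum_smul]
        refine Finset.sum_congr rfl fun k _ => ?_
        rw [hl, hl, conjTranspose_smul, Matrix.smul_mul, Matrix.mul_smul, hC, smul_smul]

end KnillLaflamme

/-! ### Operator-sum form of the insertion-deletion channel -/

section KrausForm

/-- The operator `ψ ↦ ⟨z|⊗1 · π (|x⟩⊗ψ)`, where the relabelling `τ` says which deleted or
remaining site each inserted or original qubit occupies. -/
def krausOp {N t s n : ℕ} (τ : Fin t ⊕ Fin N ≃ Fin s ⊕ Fin n) (z : Bits s) (x : Bits t) :
    Matrix (Bits n) (Bits N) ℂ :=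
  Matrix.of fun y w => if Sum.elim z y ∘ τ = Sum.elim x w then 1 else 0

/-- The relabelling of sites for the insertion structure `a` followed by the deletion of `d`. -/
def siteEquiv {N t s : ℕ} (a : InsertionStructure N t) (d : DeletionSet (N + t) s) :
    Fin t ⊕ Fin N ≃ Fin s ⊕ Fin (N + t - s) :=
  (insertionEquiv a).trans (deletionEquiv d).symm

/-- The second-moment matrix of the inserted state under the weight `w`. -/
def momentMatrix {t : ℕ} (μ : Measure (InsertionCoeff t)) (w : InsertionCoeff t → ℝ) : Op t :=
  Matrix.of fun x x' => ∫ v, (w v : ℂ) * (v.1 x * star (v.1 x')) ∂μ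

theorem sumElim_eq_iff {N t : ℕ} (u : Fin t ⊕ Fin N → Fin 2) (x : Bits t) (w : Bits N) :
    u = Sum.elim x w ↔ x = u ∘ Sum.inl ∧ w = u ∘ Sum.inr := by
  constructor
  · rintro rfl
    simp
  · rintro ⟨rfl, rfl⟩
    simp

theorem krausOp_apply {N t s n : ℕ} (τ : Fin t ⊕ Fin N ≃ Fin s ⊕ Fin n) (z : Bits s) (x : Bits t)
    (y : Bits n) (w : Bits N) :
    krausOp τ z x y w = if x = Sum.elim z y ∘ τ ∘ Sum.inl then
      if w = Sum.elim z y ∘ τ ∘ Sum.inr then 1 else 0 else 0 := by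
  rw [krausOp, Matrix.of_apply, ← ite_and]
  exact if_congr (sumElim_eq_iff _ _ _) rfl rfl

theorem krausOp_mulVec {N t s n : ℕ} (τ : Fin t ⊕ Fin N ≃ Fin s ⊕ Fin n) (z : Bits s) (x : Bits t)
    (ψ : Bits N → ℂ) (y : Bits n) :
    (krausOp τ z x *ᵥ ψ) y =
      if x = Sum.elim z y ∘ τ ∘ Sum.inl then ψ (Sum.elim z y ∘ τ ∘ Sum.inr) else 0 := by
  simp only [mulVec, dotProduct, krausOp_apply]
  split_ifs <;> simp

theorem krausOp_mul_mul_conjTranspose {N t s n : ℕ} (τ : Fin t ⊕ Fin N ≃ Fin s ⊕ Fin n)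
    (z : Bits s) (x x' : Bits t) (ρ : Op N) (y y' : Bits n) :
    (krausOp τ z x * ρ * (krausOp τ z x')ᴴ) y y' =
      if x = Sum.elim z y ∘ τ ∘ Sum.inl then if x' = Sum.elim z y' ∘ τ ∘ Sum.inl then
        ρ (Sum.elim z y ∘ τ ∘ Sum.inr) (Sum.elim z y' ∘ τ ∘ Sum.inr) else 0 else 0 := by
  simp only [Matrix.mul_apply, conjTranspose_apply, krausOp_apply]
  split_ifs <;> simp

theorem sum_smul_krausOp_mul_mul_apply {N t s n : ℕ} (τ : Fin t ⊕ Fin N ≃ Fin s ⊕ Fin n)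
    (z : Bits s) (M : Op t) (ρ : Op N) (y y' : Bits n) :
    (∑ x, ∑ x', M x x' • (krausOp τ z x * ρ * (krausOp τ z x')ᴴ)) y y' =
      M (Sum.elim z y ∘ τ ∘ Sum.inl) (Sum.elim z y' ∘ τ ∘ Sum.inl) *
        ρ (Sum.elim z y ∘ τ ∘ Sum.inr) (Sum.elim z y' ∘ τ ∘ Sum.inr) := by
  simp only [Matrix.sum_apply, Matrix.smul_apply, krausOp_mul_mul_conjTranspose, smul_eq_mul]
  simp

theorem insertAt_apply {N t : ℕ} (a : InsertionStructure N t) (σ : Op t) (ρ : Op N)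
    (u u' : Bits (N + t)) :
    insertAt a σ ρ u u' =
      σ (u ∘ insertionEquiv a ∘ Sum.inl) (u' ∘ insertionEquiv a ∘ Sum.inl) *
        ρ (u ∘ insertionEquiv a ∘ Sum.inr) (u' ∘ insertionEquiv a ∘ Sum.inr) := by
  rfl

theorem placeBits_deletionEquiv {m s : ℕ} (d : DeletionSet m s) (z : Bits s) (y : Bits (m - s)) :
    placeBits (deletionEquiv d) (z, y) = Sum.elim z y ∘ (deletionEquiv d).symm := by
  rfl

theorem insertionChannel_apply {N t : ℕ} (μ : Measure (InsertionCoeff t))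
    (p : InsertionStructure N t → InsertionCoeff t → ℝ) (ρ : Op N) (u u' : Bits (N + t)) :
    insertionChannel μ p ρ u u' = ∑ a, insertAt a (momentMatrix μ (p a)) ρ u u' := by
  simp only [insertionChannel, Matrix.sum_apply, Matrix.of_apply, insertAt_apply, momentMatrix,
    pureState, vecMulVec_apply, Pi.star_apply]
  refine Finset.sum_congr rfl fun a _ => ?_
  rw [← integral_mul_const]
  simp only [mul_assoc]

/-- The choices `a`, `d` and the traced-out bits `z` are summed incoherently. Only the inserted
strings `x`, `x'` are coupled, through the second moments of `v`. -/
theorem deletionChannel_insertionChannel {N t s : ℕ} (μ : Measure (InsertionCoeff t))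
    (p : InsertionStructure N t → InsertionCoeff t → ℝ) (q : DeletionSet (N + t) s → ℝ)
    (ρ : Op N) :
    deletionChannel q (insertionChannel μ p ρ) =
      ∑ i : InsertionStructure N t × DeletionSet (N + t) s × Bits s, ∑ x, ∑ x',
        ((q i.2.1 : ℂ) • momentMatrix μ (p i.1)) x x' •
          (krausOp (siteEquiv i.1 i.2.1) i.2.2 x * ρ *
            (krausOp (siteEquiv i.1 i.2.1) i.2.2 x')ᴴ) := by
  ext y y'
  rw [Matrix.sum_apply]
  simp only [sum_smul_krausOp_mul_mul_apply]
  simp only [deletionChannel, Matrix.sum_apply, Matrix.smul_apply, partialTrace, Matrix.of_apply,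
    insertionChannel_apply, placeBits_deletionEquiv, insertAt_apply, smul_eq_mul,
    Fintype.sum_prod_type, Finset.mul_sum]
  symm
  rw [Finset.sum_comm]
  refine Finset.sum_congr rfl fun d _ => ?_
  rw [Finset.sum_comm]
  refine Finset.sum_congr rfl fun z _ => Finset.sum_congr rfl fun a _ => ?_
  rw [mul_assoc]
  rfl

/-- The sphere is compact, so `f` is bounded. -/
theorem integrable_moment {t : ℕ} {μ : Measure (InsertionCoeff t)} {w : InsertionCoeff t → ℝ}
    (hw : Integrable w μ) {f : InsertionCoeff t → ℂ} (hf : Continuous f) :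
    Integrable (fun v => (w v : ℂ) * f v) μ := by
  obtain ⟨c, hc⟩ := isCompact_univ.exists_bound_of_continuousOn hf.continuousOn
  exact hw.ofReal.mul_bdd hf.aestronglyMeasurable (Filter.Eventually.of_forall fun v => hc v trivial)

theorem continuous_apply_coeff {t : ℕ} (x : Bits t) :
    Continuous fun v : InsertionCoeff t => v.1 x :=
  (PiLp.continuous_apply 2 _ x).comp continuous_subtype_val

theorem star_dotProduct_momentMatrix_mulVec {t : ℕ} {μ : Measure (InsertionCoeff t)}
    {w : InsertionCoeff t → ℝ} (hw : Integrable w μ) (g : Bits t → ℂ) :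
    star g ⬝ᵥ (momentMatrix μ w *ᵥ g) =
      ((∫ v, w v * ‖∑ x, star (g x) * v.1 x‖ ^ 2 ∂μ : ℝ) : ℂ) := by
  rw [← integral_complex_ofReal]
  have h : ∀ v : InsertionCoeff t, ((w v * ‖∑ x, star (g x) * v.1 x‖ ^ 2 : ℝ) : ℂ) =
      ∑ x, ∑ x', (w v : ℂ) * (v.1 x * star (v.1 x')) * (star (g x) * g x') := by
    intro v
    rw [Complex.ofReal_mul, Complex.ofReal_pow, ← Complex.mul_conj', map_sum,
      Finset.sum_mul_sum, Finset.mul_sum]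
    refine Finset.sum_congr rfl fun x _ => ?_
    rw [Finset.mul_sum]
    refine Finset.sum_congr rfl fun x' _ => ?_
    simp
    ring
  have hint : ∀ x x', Integrable (fun v : InsertionCoeff t =>
      (w v : ℂ) * (v.1 x * star (v.1 x')) * (star (g x) * g x')) μ := fun x x' =>
    (integrable_moment hw
      ((continuous_apply_coeff x).mul (continuous_apply_coeff x').star)).mul_const _
  simp only [h]
  rw [integral_finsetSum _ fun x _ => integrable_finsetSum _ fun x' _ => hint x x']
  simp only [dotProduct, mulVec, Finset.mul_sum]
  refine Finset.sum_congr rfl fun x _ => ?_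
  rw [integral_finsetSum _ fun x' _ => hint x x']
  refine Finset.sum_congr rfl fun x' _ => ?_
  rw [integral_mul_const, momentMatrix, Matrix.of_apply, Pi.star_apply]
  ring

/-- The quadratic form at `g` is the integral of `w v * |⟨g, v⟩|²`. Its support is open, and for `g
≠ 0` it contains the basis vector at any `x₀` with `g x₀ ≠ 0`, so it has positive measure. -/
theorem momentMatrix_posDef {t : ℕ} {μ : Measure (InsertionCoeff t)} [μ.IsOpenPosMeasure]
    {w : InsertionCoeff t → ℝ} (hw : Integrable w μ) (hpos : ∀ v, 0 < w v) :
    (momentMatrix μ w).PosDef := by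
  refine PosDef.of_dotProduct_mulVec_pos (IsHermitian.ext fun x x' => ?_) fun g hg => ?_
  · rw [momentMatrix, Matrix.of_apply, Matrix.of_apply]
    refine (integral_conj (𝕜 := ℂ)).symm.trans (integral_congr_ae (.of_forall fun v => ?_))
    simp [mul_comm]
  · rw [star_dotProduct_momentMatrix_mulVec hw, Complex.zero_lt_real]
    have hcont : Continuous fun v : InsertionCoeff t => ∑ x, star (g x) * v.1 x :=
      continuous_finsetSum _ fun x _ => continuous_const.mul (continuous_apply_coeff x)
    have hint : Integrable (fun v => w v * ‖∑ x, star (g x) * v.1 x‖ ^ 2) μ := by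
      have := (integrable_moment hw (f := fun v => ((‖∑ x, star (g x) * v.1 x‖ ^ 2 : ℝ) : ℂ))
        (Complex.continuous_ofReal.comp (hcont.norm.pow 2))).re
      simpa [← Complex.ofReal_mul, ← Complex.ofReal_pow] using this
    rw [integral_pos_iff_support_of_nonneg
      (fun v => mul_nonneg (hpos v).le (sq_nonneg _)) hint]
    have hsupp : Function.support (fun v : InsertionCoeff t =>
        w v * ‖∑ x, star (g x) * v.1 x‖ ^ 2) = {v | ∑ x, star (g x) * v.1 x ≠ 0} := by
      ext v
      simp [(hpos v).ne']
    rw [hsupp]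
    refine (isOpen_ne_fun hcont continuous_const).measure_pos μ ?_
    obtain ⟨x₀, hx₀⟩ := Function.ne_iff.1 hg
    refine ⟨⟨EuclideanSpace.single x₀ 1, by simp⟩, ?_⟩
    simpa [Pi.single_apply] using hx₀

theorem trace_momentMatrix {t : ℕ} {μ : Measure (InsertionCoeff t)}
    {w : InsertionCoeff t → ℝ} (hw : Integrable w μ) :
    (momentMatrix μ w).trace = ((∫ v, w v ∂μ : ℝ) : ℂ) := by
  simp only [trace, diag_apply, momentMatrix, Matrix.of_apply]
  have hint : ∀ x, Integrable (fun v : InsertionCoeff t =>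
      (w v : ℂ) * (v.1 x * star (v.1 x))) μ := fun x =>
    integrable_moment hw ((continuous_apply_coeff x).mul (continuous_apply_coeff x).star)
  rw [← integral_finsetSum _ fun x _ => hint x]
  rw [← integral_complex_ofReal]
  refine integral_congr_ae (.of_forall fun v => ?_)
  have hv : ‖v.1‖ ^ 2 = 1 := by simp
  rw [EuclideanSpace.norm_sq_eq] at hv
  simp only [← Finset.mul_sum, RCLike.star_def, Complex.mul_conj']
  rw [show (∑ x, (‖v.1 x‖ : ℂ) ^ 2) = ((∑ x, ‖v.1 x‖ ^ 2 : ℝ) : ℂ) by push_cast; rfl, hv]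
  simp

theorem trace_insertAt {N t : ℕ} (a : InsertionStructure N t) (σ : Op t) (ρ : Op N) :
    (insertAt a σ ρ).trace = σ.trace * ρ.trace := by
  rw [← trace_kronecker, insertAt, trace, trace]
  exact (placeBits (insertionEquiv a)).symm.sum_comp (fun i => (σ ⊗ₖ ρ) i i)

theorem trace_partialTrace {m s : ℕ} (d : DeletionSet m s) (ρ : Op m) :
    (partialTrace d ρ).trace = ρ.trace := by
  simp only [trace, diag_apply, partialTrace, Matrix.of_apply]
  rw [Finset.sum_comm, ← Fintype.sum_prod_type'
    (f := fun z y => ρ (placeBits (deletionEquiv d) (z, y)) (placeBits (deletionEquiv d) (z, y)))]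
  exact (placeBits (deletionEquiv d)).sum_comp (fun i => ρ i i)

theorem trace_deletionChannel_insertionChannel {N t s : ℕ} {μ : Measure (InsertionCoeff t)}
    {p : InsertionStructure N t → InsertionCoeff t → ℝ} (hp_int : ∀ a, Integrable (p a) μ)
    (hp_sum : ∑ a, ∫ v, p a v ∂μ = 1) {q : DeletionSet (N + t) s → ℝ} (hq_sum : ∑ d, q d = 1)
    (ρ : Op N) : (deletionChannel q (insertionChannel μ p ρ)).trace = ρ.trace := by
  have h : insertionChannel μ p ρ = ∑ a, insertAt a (momentMatrix μ (p a)) ρ := by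
    ext u u'
    rw [insertionChannel_apply, Matrix.sum_apply]
  simp only [deletionChannel, trace_sum, trace_smul, trace_partialTrace, h, trace_insertAt]
  rw [← Finset.sum_smul, ← Finset.sum_mul]
  simp only [trace_momentMatrix (hp_int _)]
  rw [← Complex.ofReal_sum, ← Complex.ofReal_sum, hp_sum, hq_sum]
  simp

/-- A block-diagonal matrix with positive definite blocks is positive definite. -/
theorem posDef_of_blocks {I T : Type*} [Fintype I] [DecidableEq I] [Fintype T]
    (M : I → Matrix T T ℂ) (hM : ∀ i, (M i).PosDef) :
    (Matrix.of fun k l : I × T => if k.1 = l.1 then M k.1 k.2 l.2 else 0).PosDef := by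
  refine PosDef.of_dotProduct_mulVec_pos (IsHermitian.ext fun k l => ?_) fun g hg => ?_
  · simp only [Matrix.of_apply]
    by_cases h : k.1 = l.1
    · rw [if_pos h, if_pos h.symm, h]
      exact (hM l.1).isHermitian.apply _ _
    · rw [if_neg h, if_neg (Ne.symm h), star_zero]
  · have hsum : star g ⬝ᵥ ((Matrix.of fun k l : I × T =>
        if k.1 = l.1 then M k.1 k.2 l.2 else 0) *ᵥ g) =
        ∑ i, star (fun x => g (i, x)) ⬝ᵥ (M i *ᵥ fun x => g (i, x)) := by
      simp only [dotProduct, mulVec, Fintype.sum_prod_type, Matrix.of_apply, Pi.star_apply]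
      refine Finset.sum_congr rfl fun i _ => Finset.sum_congr rfl fun x _ => ?_
      rw [Finset.sum_eq_single i] <;> simp +contextual [eq_comm]
    rw [hsum]
    obtain ⟨⟨i, x⟩, hix⟩ := Function.ne_iff.1 hg
    refine Finset.sum_pos' (fun j _ => (hM j).posSemidef.dotProduct_mulVec_nonneg _)
      ⟨i, Finset.mem_univ _, (hM i).dotProduct_mulVec_pos fun h => hix ?_⟩
    exact congrFun h x

/-- The Knill–Laflamme conditions for insertions followed by deletions. -/
theorem isCorrectable_iff_scalar_gram {N s t : ℕ} (C : Matrix (Bits N) (Fin 2) ℂ)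
    (hC : Cᴴ * C = 1) (μ : Measure (InsertionCoeff t)) [μ.IsOpenPosMeasure]
    (p : InsertionStructure N t → InsertionCoeff t → ℝ)
    (hp_pos : ∀ a v, 0 < p a v) (hp_int : ∀ a, Integrable (p a) μ)
    (hp_sum : ∑ a, ∫ v, p a v ∂μ = 1)
    (q : DeletionSet (N + t) s → ℝ) (hq_pos : ∀ d, 0 < q d) (hq_sum : ∑ d, q d = 1) :
    IsCorrectable (LinearMap.range C.mulVecLin)
        (fun ρ => deletionChannel q (insertionChannel μ p ρ)) ↔
      ∀ (a : InsertionStructure N t) (d : DeletionSet (N + t) s) (z : Bits s) (x : Bits t)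
        (a' : InsertionStructure N t) (d' : DeletionSet (N + t) s) (z' : Bits s) (x' : Bits t),
        ∃ l : ℂ, (krausOp (siteEquiv a d) z x * C)ᴴ * (krausOp (siteEquiv a' d') z' x' * C) =
          l • (1 : Matrix (Fin 2) (Fin 2) ℂ) := by
  classical
  let I := InsertionStructure N t × DeletionSet (N + t) s × Bits s
  let M : I → Op t := fun i => (q i.2.1 : ℂ) • momentMatrix μ (p i.1)
  let A : I × Bits t → Matrix (Bits (N + t - s)) (Bits N) ℂ :=
    fun k => krausOp (siteEquiv k.1.1 k.1.2.1) k.1.2.2 k.2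
  let c : Matrix (I × Bits t) (I × Bits t) ℂ :=
    Matrix.of fun k l => if k.1 = l.1 then M k.1 k.2 l.2 else 0
  have hc : c.PosDef := posDef_of_blocks M fun i =>
    (momentMatrix_posDef (hp_int i.1) (hp_pos i.1)).smul
      (by exact_mod_cast hq_pos i.2.1)
  have hE : ∀ ψ : Bits N → ℂ, deletionChannel q (insertionChannel μ p (pureState ψ)) =
      ∑ k, ∑ l, c k l • (A k * pureState ψ * (A l)ᴴ) := by
    intro ψ
    rw [deletionChannel_insertionChannel]
    refine Eq.trans ?_ (Fintype.sum_prod_type _).symm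
    refine Finset.sum_congr rfl fun i _ => Finset.sum_congr rfl fun x _ => ?_
    rw [Fintype.sum_prod_type, Finset.sum_eq_single i]
    · simp [c, A, M]
    · intro j _ hj
      simp [c, hj.symm]
    · simp
  constructor
  · intro h a d z x a' d' z' x'
    exact scalar_gram_of_isCorrectable C hC A c hc _ hE h ((a, d, z), x) ((a', d', z'), x')
  · intro h
    refine isCorrectable_of_scalar_gram C hC A c _ hE (fun ψ hψ => ?_) fun k l => h _ _ _ _ _ _ _ _
    rw [← hψ]
    exact trace_deletionChannel_insertionChannel hp_int hp_sum hq_sum _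

end KrausForm

/-! ### Gram entries as binomial sums -/

section Overlap

variable {N t s n : ℕ}

/-- The sum over the remaining bits of a function of the weights of the two original registers,
restricted to the bits that are compatible with the inserted bits `x`, `x'`. -/
def overlap (τ τ' : Fin t ⊕ Fin N ≃ Fin s ⊕ Fin n) (z z' : Bits s) (x x' : Bits t)
    (H : ℕ → ℕ → ℂ) : ℂ :=
  ∑ y : Bits n, if x = Sum.elim z y ∘ τ ∘ Sum.inl ∧ x' = Sum.elim z' y ∘ τ' ∘ Sum.inl then
    H (weight (Sum.elim z y ∘ τ ∘ Sum.inr)) (weight (Sum.elim z' y ∘ τ' ∘ Sum.inr)) else 0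

/-- `∑ₖ C(r,k) H(a+k, b+k)`. -/
def binomialSum (H : ℕ → ℕ → ℂ) (r a b : ℕ) : ℂ :=
  ∑ k ∈ Finset.range (r + 1), (r.choose k : ℂ) * H (a + k) (b + k)

/-- The remaining sites that carry an original qubit. -/
def originalRemaining (τ : Fin t ⊕ Fin N ≃ Fin s ⊕ Fin n) : Finset (Fin n) :=
  Finset.univ.filter fun i => (τ.symm (Sum.inr i)).isRight

/-- Set the bits in `Q` to one. -/
def raise (y : Bits n) (Q : Finset (Fin n)) : Bits n := fun i => if i ∈ Q then 1 else y i

theorem weight_le (x : Bits n) : weight x ≤ n := by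
  calc weight x ≤ ∑ _i : Fin n, 1 := Finset.sum_le_sum fun i _ => by have := (x i).2; omega
    _ = n := by simp

/-- A string agreeing with `y₀` off `P` is determined by the subset of `P` on which it is one. -/
theorem sum_eq_sum_powerset_raise (P : Finset (Fin n)) (y₀ : Bits n) (hy₀ : ∀ i ∈ P, y₀ i = 0)
    (f : Bits n → ℂ) :
    (∑ y, if ∀ i, i ∉ P → y i = y₀ i then f y else 0) = ∑ Q ∈ P.powerset, f (raise y₀ Q) := by
  rw [← Finset.sum_filter]
  refine Finset.sum_bij' (fun y _ => P.filter fun i => y i = 1) (fun Q _ => raise y₀ Q)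
    ?_ ?_ ?_ ?_ ?_
  · intro y _
    simp
  · intro Q hQ
    rw [Finset.mem_powerset] at hQ
    simp only [Finset.mem_filter, Finset.mem_univ, true_and, raise]
    intro i hi
    rw [if_neg fun h => hi (hQ h)]
  · intro y hy
    simp only [Finset.mem_filter, Finset.mem_univ, true_and] at hy
    ext i
    by_cases hi : i ∈ P
    · have h2 := (y i).2
      by_cases h1 : y i = 1
      · simp [raise, hi, h1]
      · have h0 : y i = 0 := by omega
        simp [raise, hi, h0, hy₀]
    · simp [raise, hi, hy i hi]
  · intro Q hQ
    rw [Finset.mem_powerset] at hQ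
    ext i
    refine Finset.mem_filter.trans ?_
    simp only [raise]
    constructor
    · rintro ⟨hi, h⟩
      by_contra hQi
      rw [if_neg hQi, hy₀ i hi] at h
      exact absurd h (by decide)
    · intro h
      exact ⟨hQ h, by rw [if_pos h]⟩
  · intro y hy
    simp only [Finset.mem_filter, Finset.mem_univ, true_and] at hy
    congr 1
    ext i
    by_cases hi : i ∈ P
    · have h2 := (y i).2
      by_cases h1 : y i = 1
      · simp [raise, hi, h1]
      · have h0 : y i = 0 := by omega
        simp [raise, hi, h0, hy₀]
    · simp [raise, hi, hy i hi]

/-- Each site of `Q` carries exactly one original qubit, so each raised bit adds one to the original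
weight. -/
theorem weight_raise (τ : Fin t ⊕ Fin N ≃ Fin s ⊕ Fin n) (z : Bits s) (y : Bits n)
    (Q : Finset (Fin n)) (hQ : Q ⊆ originalRemaining τ) (hy : ∀ i ∈ Q, y i = 0) :
    weight (Sum.elim z (raise y Q) ∘ τ ∘ Sum.inr) =
      weight (Sum.elim z y ∘ τ ∘ Sum.inr) + Q.card := by
  have hpt : ∀ c : Fin s ⊕ Fin n, ((Sum.elim z (raise y Q) c : Fin 2) : ℕ) =
      (Sum.elim z y c : Fin 2) + ∑ i ∈ Q, if c = Sum.inr i then 1 else 0 := by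
    rintro (c | c)
    · simp
    · by_cases hc : c ∈ Q
      · simp [raise, hc, hy]
      · simp [raise, hc]
  have hcard : ∑ k : Fin N, ∑ i ∈ Q, (if τ (Sum.inr k) = Sum.inr i then 1 else 0) = Q.card := by
    rw [Finset.sum_comm, Finset.card_eq_sum_ones]
    refine Finset.sum_congr rfl fun i hi => ?_
    have hr := hQ hi
    simp only [originalRemaining, Finset.mem_filter, Finset.mem_univ, true_and] at hr
    obtain ⟨k, hk⟩ := Sum.isRight_iff.1 hr
    rw [Finset.sum_eq_single k]
    · rw [← hk, Equiv.apply_symm_apply, if_pos rfl]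
    · intro l _ hl
      rw [if_neg]
      intro h
      rw [← h, Equiv.symm_apply_apply] at hk
      exact hl (Sum.inr_injective hk)
    · simp
  simp only [weight, Function.comp_apply, hpt, Finset.sum_add_distrib, hcard]

/-- A remaining site with an inserted qubit on either side has its bit prescribed by `x` or `x'`.
The jointly original sites are free, and setting `k` of them to one raises both weights by `k`. -/
theorem overlap_eq_binomialSum (τ τ' : Fin t ⊕ Fin N ≃ Fin s ⊕ Fin n) (z z' : Bits s)
    (x x' : Bits t) (y : Bits n)
    (hy : ∀ i ∈ originalRemaining τ ∩ originalRemaining τ', y i = 0)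
    (hx : x = Sum.elim z y ∘ τ ∘ Sum.inl) (hx' : x' = Sum.elim z' y ∘ τ' ∘ Sum.inl)
    (H : ℕ → ℕ → ℂ) :
    overlap τ τ' z z' x x' H = binomialSum H (originalRemaining τ ∩ originalRemaining τ').card
      (weight (Sum.elim z y ∘ τ ∘ Sum.inr)) (weight (Sum.elim z' y ∘ τ' ∘ Sum.inr)) := by
  set P := originalRemaining τ ∩ originalRemaining τ' with hP
  have hmatch : ∀ (τ : Fin t ⊕ Fin N ≃ Fin s ⊕ Fin n) (z : Bits s) (y' : Bits n),
      Sum.elim z y ∘ τ ∘ Sum.inl = Sum.elim z y' ∘ τ ∘ Sum.inl ↔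
        ∀ i ∉ originalRemaining τ, y' i = y i := by
    intro τ z y'
    constructor
    · intro h i hi
      simp only [originalRemaining, Finset.mem_filter, Finset.mem_univ, true_and,
        Sum.not_isRight, Sum.isLeft_iff] at hi
      obtain ⟨j, hj⟩ := hi
      have := congrFun h j
      simp only [Function.comp_apply, ← hj, Equiv.apply_symm_apply, Sum.elim_inr] at this
      exact this.symm
    · intro h
      ext j
      simp only [Function.comp_apply]
      rcases hc : τ (Sum.inl j) with c | c
      · rfl
      · have : y' c = y c := by
          apply h
          simp [originalRemaining, ← hc]
        simp [this]
  have hcond : ∀ y' : Bits n, (x = Sum.elim z y' ∘ τ ∘ Sum.inl ∧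
      x' = Sum.elim z' y' ∘ τ' ∘ Sum.inl) ↔ ∀ i, i ∉ P → y' i = y i := by
    intro y'
    rw [hx, hx', hmatch, hmatch, hP]
    constructor
    · rintro ⟨h1, h2⟩ i hi
      by_cases hi1 : i ∈ originalRemaining τ
      · exact h2 i fun hi2 => hi (Finset.mem_inter.2 ⟨hi1, hi2⟩)
      · exact h1 i hi1
    · intro h
      exact ⟨fun i hi => h i fun hi' => hi (Finset.mem_inter.1 hi').1,
        fun i hi => h i fun hi' => hi (Finset.mem_inter.1 hi').2⟩
  have h1 : overlap τ τ' z z' x x' H = ∑ y' : Bits n, if ∀ i, i ∉ P → y' i = y i then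
      H (weight (Sum.elim z y' ∘ τ ∘ Sum.inr)) (weight (Sum.elim z' y' ∘ τ' ∘ Sum.inr)) else 0 :=
    Finset.sum_congr rfl fun y' _ => if_congr (hcond y') rfl rfl
  rw [h1, sum_eq_sum_powerset_raise P y hy]
  have h2 : ∀ Q ∈ P.powerset, H (weight (Sum.elim z (raise y Q) ∘ τ ∘ Sum.inr))
      (weight (Sum.elim z' (raise y Q) ∘ τ' ∘ Sum.inr)) =
      H (weight (Sum.elim z y ∘ τ ∘ Sum.inr) + Q.card)
        (weight (Sum.elim z' y ∘ τ' ∘ Sum.inr) + Q.card) := by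
    intro Q hQ
    rw [Finset.mem_powerset] at hQ
    rw [weight_raise τ z y Q (hQ.trans Finset.inter_subset_left) fun i hi => hy i (hQ hi),
      weight_raise τ' z' y Q (hQ.trans Finset.inter_subset_right) fun i hi => hy i (hQ hi)]
  rw [Finset.sum_congr rfl h2, Finset.sum_powerset_apply_card (fun k =>
    H (weight (Sum.elim z y ∘ τ ∘ Sum.inr) + k) (weight (Sum.elim z' y ∘ τ' ∘ Sum.inr) + k)),
    binomialSum]
  simp only [nsmul_eq_mul]

theorem card_originalRemaining_compl_le (τ : Fin t ⊕ Fin N ≃ Fin s ⊕ Fin n) :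
    (originalRemaining τ)ᶜ.card ≤ t := by
  have h : ((originalRemaining τ)ᶜ.map
      (Function.Embedding.inr.trans τ.symm.toEmbedding)) ⊆
      (Finset.univ : Finset (Fin t)).map Function.Embedding.inl := by
    intro c hc
    simp only [Finset.mem_map, Finset.mem_compl, originalRemaining, Finset.mem_filter,
      Finset.mem_univ, true_and, Sum.not_isRight, Sum.isLeft_iff] at hc ⊢
    obtain ⟨i, ⟨j, hj⟩, rfl⟩ := hc
    exact ⟨j, hj.symm⟩
  simpa using Finset.card_le_card h

/-- Each side fixes at most `t` remaining sites, which bounds `r` below. Raising all `r` free bits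
still leaves a string of `N` original bits, whence `a + r ≤ N` and `b + r ≤ N`. -/
theorem overlap_eq_zero (τ τ' : Fin t ⊕ Fin N ≃ Fin s ⊕ Fin n) (z z' : Bits s)
    (x x' : Bits t) (H : ℕ → ℕ → ℂ)
    (hH : ∀ r a b, N ≤ r + s + t → r ≤ n → a + r ≤ N → b + r ≤ N → binomialSum H r a b = 0) :
    overlap τ τ' z z' x x' H = 0 := by
  by_cases hex : ∃ y : Bits n, x = Sum.elim z y ∘ τ ∘ Sum.inl ∧ x' = Sum.elim z' y ∘ τ' ∘ Sum.inl
  · obtain ⟨y₁, h₁, h₁'⟩ := hex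
    set P := originalRemaining τ ∩ originalRemaining τ' with hP
    -- Clearing the free bits keeps `y` compatible, since no inserted qubit sits on `P`.
    let y : Bits n := fun i => if i ∈ P then 0 else y₁ i
    have hy : ∀ i ∈ P, y i = 0 := fun i hi => by simp [y, hi]
    have hmatch : ∀ (τ : Fin t ⊕ Fin N ≃ Fin s ⊕ Fin n) (z : Bits s), P ⊆ originalRemaining τ →
        Sum.elim z y₁ ∘ τ ∘ Sum.inl = Sum.elim z y ∘ τ ∘ Sum.inl := by
      intro τ z hPτ
      ext j
      simp only [Function.comp_apply]
      rcases hc : τ (Sum.inl j) with c | c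
      · rfl
      · have : c ∉ P := by
          intro hcP
          have := hPτ hcP
          simp [originalRemaining, ← hc] at this
        simp [y, this]
    rw [hmatch τ z Finset.inter_subset_left] at h₁
    rw [hmatch τ' z' Finset.inter_subset_right] at h₁'
    rw [overlap_eq_binomialSum τ τ' z z' x x' y hy h₁ h₁', ← hP]
    have hn : t + N = s + n := by simpa using Fintype.card_congr τ
    have hPn : P.card ≤ n := by simpa using Finset.card_le_univ P
    have hPc : Pᶜ.card ≤ t + t := by
      rw [hP, Finset.compl_inter]
      exact (Finset.card_union_le _ _).trans (add_le_add (card_originalRemaining_compl_le τ)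
        (card_originalRemaining_compl_le τ'))
    rw [Finset.card_compl, Fintype.card_fin] at hPc
    apply hH
    · omega
    · exact hPn
    · rw [← weight_raise τ z y P Finset.inter_subset_left hy]
      exact weight_le _
    · rw [← weight_raise τ' z' y P Finset.inter_subset_right hy]
      exact weight_le _
  · exact Finset.sum_eq_zero fun y _ => if_neg fun h => hex ⟨y, h⟩

end Overlap

/-! ### Insertion patterns attaining the least number of free sites -/

section Extremal

variable {N t s : ℕ}

/-- All `t` qubits are inserted in position `i`. -/
def blockInsertion (t : ℕ) (i : Fin (N + 1)) : InsertionStructure N t :=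
  ⟨Pi.single i t, by simp⟩

theorem originalSite_blockInsertion (i : Fin (N + 1)) (k : Fin N) :
    (originalSite (blockInsertion t i) k : ℕ) = k + if (i : ℕ) ≤ k then t else 0 := by
  simp only [originalSite, blockInsertion, Finset.sum_pi_single', Finset.mem_Iic]
  rfl

theorem sum_insertionEquiv_inr (a : InsertionStructure N t) (f : Fin (N + t) → ℕ) :
    ∑ k, f (insertionEquiv a (Sum.inr k)) = ∑ k, f (originalSite a k) := by
  simp only [insertionEquiv, finSumEquivOfFinset_inr]
  rw [← Finset.sum_image (f := f) (g := (insertedSites a)ᶜ.orderEmbOfFin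
      (card_insertedSites_compl a)) (fun _ _ _ _ h => ((insertedSites a)ᶜ.orderEmbOfFin _).injective h),
    Finset.image_orderEmbOfFin_univ, insertedSites, compl_compl,
    Finset.sum_image fun _ _ _ _ h => originalSite_injective a h]

theorem isRight_insertionEquiv_symm (a : InsertionStructure N t) (j : Fin (N + t)) :
    ((insertionEquiv a).symm j).isRight ↔ ∃ k, originalSite a k = j := by
  obtain ⟨c, rfl⟩ := (insertionEquiv a).surjective j
  rw [Equiv.symm_apply_apply]
  rcases c with c | c
  · have h : insertionEquiv a (Sum.inl c) ∈ insertedSites a := by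
      rw [insertionEquiv, finSumEquivOfFinset_inl]
      exact Finset.orderEmbOfFin_mem _ _ _
    simpa [insertedSites] using h
  · have h : insertionEquiv a (Sum.inr c) ∈ (insertedSites a)ᶜ := by
      rw [insertionEquiv, finSumEquivOfFinset_inr]
      exact Finset.orderEmbOfFin_mem _ _ _
    simpa [insertedSites] using h

theorem isRight_blockInsertion_symm (i : Fin (N + 1)) (j : Fin (N + t)) :
    ((insertionEquiv (blockInsertion t i)).symm j).isRight ↔ (j : ℕ) < i ∨ (i : ℕ) + t ≤ j := by
  rw [isRight_insertionEquiv_symm]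
  have hi := i.2
  have hj := j.2
  constructor
  · rintro ⟨k, rfl⟩
    rw [originalSite_blockInsertion]
    split_ifs <;> omega
  · rintro (h | h)
    · refine ⟨⟨j, by omega⟩, Fin.ext ?_⟩
      rw [originalSite_blockInsertion, if_neg (by simpa using h)]
      simp
    · refine ⟨⟨j - t, by omega⟩, Fin.ext ?_⟩
      rw [originalSite_blockInsertion, if_pos (by simp; omega)]
      simp
      omega

/-- Deletion of the first `s` sites. -/
def initialDeletion {m s : ℕ} (h : s ≤ m) : DeletionSet m s :=
  ⟨Finset.univ.filter fun j : Fin m => (j : ℕ) < s,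
    Fin.card_filter_val_lt.trans (min_eq_right h)⟩

theorem deletionEquiv_inl_mem {m : ℕ} (d : DeletionSet m s) (c : Fin s) :
    deletionEquiv d (Sum.inl c) ∈ d.1 := by
  rw [deletionEquiv, finSumEquivOfFinset_inl]
  exact Finset.orderEmbOfFin_mem _ _ _

theorem deletionEquiv_inr_notMem {m : ℕ} (d : DeletionSet m s) (c : Fin (m - s)) :
    deletionEquiv d (Sum.inr c) ∉ d.1 := by
  rw [← Finset.mem_compl, deletionEquiv, finSumEquivOfFinset_inr]
  exact Finset.orderEmbOfFin_mem _ _ _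

theorem sum_ite_val_lt {a : ℕ} (h : a ≤ N) : ∑ k : Fin N, (if (k : ℕ) < a then 1 else 0) = a := by
  rw [← Finset.sum_filter, ← Finset.card_eq_sum_ones, Fin.card_filter_val_lt, min_eq_right h]

/-- Every extremal binomial sum occurs as an overlap. -/
theorem exists_overlap_eq_binomialSum (hs : s ≤ N + t) {a b : ℕ} (ha : a ≤ N - (N - s - t))
    (hb : b ≤ N - (N - s - t)) :
    ∃ (A A' : InsertionStructure N t) (d : DeletionSet (N + t) s) (z z' : Bits s)
      (x x' : Bits t), ∀ H,
        overlap (siteEquiv A d) (siteEquiv A' d) z z' x x' H = binomialSum H (N - s - t) a b := by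
  -- The first `s` sites are deleted. `A` puts its block of `t` directly behind them and `A'`
  -- directly behind that block, so the two blocks are disjoint and `N - s - t` sites stay free. The
  -- minima treat small `N`, where no site is free.
  let i : Fin (N + 1) := ⟨min N s, by omega⟩
  let i' : Fin (N + 1) := ⟨min N (s + t), by omega⟩
  let A := blockInsertion t i
  let A' := blockInsertion t i'
  let d := initialDeletion hs
  -- The weights `a` and `b` are tuned separately. On the deleted sites the two sides may use
  -- different strings `z`. Behind them, the first `t` sites count at most for `A'` and supply `b -
  -- min N s` ones; the sites from `s + t` on supply `a - min N s` ones to `A`, within its original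
  -- qubits.
  let bit : ℕ → ℕ → Fin 2 := fun c j =>
    if (j < s ∧ j < c ∧ j < min N s) ∨ (s ≤ j ∧ (j - s < b - min N s ∨
      (t ≤ j - s ∧ j - s < t + (a - min N s)))) then 1 else 0
  let u : ℕ → Bits (N + t) := fun c j => bit c j
  have hmem : ∀ j : Fin (N + t), j ∈ d.1 ↔ (j : ℕ) < s := fun j => by
    simp [d, initialDeletion]
  let z : ℕ → Bits s := fun c => u c ∘ deletionEquiv d ∘ Sum.inl
  let y : Bits (N + t - s) := u a ∘ deletionEquiv d ∘ Sum.inr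
  -- The parameter `c` affects deleted sites only, so both sides share the same remaining string.
  have hy : ∀ c, y = u c ∘ deletionEquiv d ∘ Sum.inr := by
    intro c
    ext k
    have hk := deletionEquiv_inr_notMem d k
    rw [hmem] at hk
    simp [y, u, bit, hk]
  have helim : ∀ c, Sum.elim (z c) y = u c ∘ deletionEquiv d := by
    intro c
    rw [hy c]
    ext (k | k) <;> rfl
  have hweight : ∀ c B, Sum.elim (z c) y ∘ siteEquiv B d ∘ Sum.inr =
      u c ∘ insertionEquiv B ∘ Sum.inr := by
    intro c B
    rw [helim]
    ext k
    simp [siteEquiv]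
  have hfree : ∀ B k, k ∈ originalRemaining (siteEquiv B d) ↔
      ((insertionEquiv B).symm (deletionEquiv d (Sum.inr k))).isRight := by
    intro B k
    rw [originalRemaining, Finset.mem_filter]
    simp [siteEquiv]
  have hfree' : ∀ k, k ∈ originalRemaining (siteEquiv A d) ∩ originalRemaining (siteEquiv A' d) ↔
      s + 2 * t ≤ deletionEquiv d (Sum.inr k) := by
    intro k
    have hk := deletionEquiv_inr_notMem d k
    rw [hmem] at hk
    rw [Finset.mem_inter, hfree, hfree, isRight_blockInsertion_symm, isRight_blockInsertion_symm]
    have := (deletionEquiv d (Sum.inr k)).2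
    simp only [i, i']
    omega
  have hcard : (originalRemaining (siteEquiv A d) ∩ originalRemaining (siteEquiv A' d)).card =
      N - s - t := by
    rw [← Finset.card_map (Function.Embedding.inr.trans (deletionEquiv d).toEmbedding)]
    have : (originalRemaining (siteEquiv A d) ∩ originalRemaining (siteEquiv A' d)).map
        (Function.Embedding.inr.trans (deletionEquiv d).toEmbedding) =
        (Finset.univ.filter fun j : Fin (N + t) => (j : ℕ) < s + 2 * t)ᶜ := by
      ext j
      simp only [Finset.mem_map, hfree', Finset.mem_compl, Finset.mem_filter, Finset.mem_univ,
        true_and, not_lt]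
      constructor
      · rintro ⟨k, hk, rfl⟩
        exact hk
      · intro hj
        obtain ⟨c, rfl⟩ := (deletionEquiv d).surjective j
        rcases c with c | c
        · have := deletionEquiv_inl_mem d c
          rw [hmem] at this
          omega
        · exact ⟨c, hj, rfl⟩
    rw [this, Finset.card_compl, Fin.card_filter_val_lt, Fintype.card_fin]
    omega
  have hyfree : ∀ k ∈ originalRemaining (siteEquiv A d) ∩ originalRemaining (siteEquiv A' d),
      y k = 0 := by
    intro k hk
    rw [hfree'] at hk
    have := (deletionEquiv d (Sum.inr k)).2
    simp only [y, u, bit, Function.comp_apply]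
    rw [if_neg]
    omega
  have hA : weight (Sum.elim (z a) y ∘ siteEquiv A d ∘ Sum.inr) = a := by
    rw [hweight]
    calc weight (u a ∘ insertionEquiv A ∘ Sum.inr)
        = ∑ k, ((u a (originalSite A k) : Fin 2) : ℕ) :=
          sum_insertionEquiv_inr A fun j => ((u a j : Fin 2) : ℕ)
      _ = ∑ k : Fin N, (if (k : ℕ) < a then 1 else 0) := by
          refine Finset.sum_congr rfl fun k _ => ?_
          have hk := k.2
          simp only [u, bit, A, originalSite_blockInsertion, i]
          rw [apply_ite Fin.val]
          refine if_congr ?_ rfl rfl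
          split_ifs <;> omega
      _ = a := sum_ite_val_lt (by omega)
  have hB : weight (Sum.elim (z b) y ∘ siteEquiv A' d ∘ Sum.inr) = b := by
    rw [hweight]
    calc weight (u b ∘ insertionEquiv A' ∘ Sum.inr)
        = ∑ k, ((u b (originalSite A' k) : Fin 2) : ℕ) :=
          sum_insertionEquiv_inr A' fun j => ((u b j : Fin 2) : ℕ)
      _ = ∑ k : Fin N, (if (k : ℕ) < b then 1 else 0) := by
          refine Finset.sum_congr rfl fun k _ => ?_
          have hk := k.2
          simp only [u, bit, A', originalSite_blockInsertion, i']
          rw [apply_ite Fin.val]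
          refine if_congr ?_ rfl rfl
          split_ifs <;> omega
      _ = b := sum_ite_val_lt (by omega)
  refine ⟨A, A', d, z a, z b, Sum.elim (z a) y ∘ siteEquiv A d ∘ Sum.inl,
    Sum.elim (z b) y ∘ siteEquiv A' d ∘ Sum.inl, fun H => ?_⟩
  rw [overlap_eq_binomialSum _ _ _ _ _ _ y hyfree rfl rfl, hcard, hA, hB]

end Extremal

/-! ### Codeword amplitudes, reduction by Pascal's rule, and index ranges -/

section Amplitudes

variable {N : ℕ}

/-- The amplitude of a permutation-invariant codeword on the basis states of weight `k`. -/
def amplitude (γ : Fin (N + 1) → ℂ) (k : ℕ) : ℂ :=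
  coeff γ k / ((Real.sqrt (N.choose k) : ℝ) : ℂ)

/-- The sesquilinear pairing of amplitudes. -/
def amplitudePairing (γ δ : Fin (N + 1) → ℂ) (k l : ℕ) : ℂ :=
  star (amplitude γ k) * amplitude δ l

/-- The matrix whose columns are the two codewords. -/
def codeMatrix (α β : Fin (N + 1) → ℂ) : Matrix (Bits N) (Fin 2) ℂ :=
  Matrix.of fun w i => amplitude (![α, β] i) (weight w)

theorem codeword_apply (γ : Fin (N + 1) → ℂ) (x : Bits N) :
    codeword γ x = amplitude γ (weight x) := by
  have hx : weight x < N + 1 := Nat.lt_succ_of_le (weight_le x)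
  rw [codeword, Finset.sum_apply, Finset.sum_eq_single ⟨weight x, hx⟩]
  · simp [dicke, amplitude, coeff, hx, div_eq_mul_inv]
  · intro k _ hk
    have : weight x ≠ k := fun h => hk (Fin.ext h.symm)
    simp [dicke, this]
  · simp

theorem sum_weight (f : ℕ → ℂ) :
    ∑ w : Bits N, f (weight w) = ∑ k ∈ Finset.range (N + 1), (N.choose k : ℂ) * f k := by
  have h := sum_eq_sum_powerset_raise (n := N) Finset.univ 0 (fun _ _ => rfl)
    (fun w => f (weight w))
  simp only [Finset.mem_univ, not_true_eq_false, false_imp_iff, implies_true, if_true] at h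
  have hw : ∀ Q : Finset (Fin N), weight (raise 0 Q) = Q.card := by
    intro Q
    simp only [weight, raise, apply_ite Fin.val]
    simp
  simp only [hw] at h
  rw [h, Finset.sum_powerset_apply_card f]
  simp

theorem sum_star_amplitude_mul_amplitude (γ δ : Fin (N + 1) → ℂ) :
    ∑ w : Bits N, star (amplitude γ (weight w)) * amplitude δ (weight w) =
      ∑ k, star (γ k) * δ k := by
  rw [sum_weight (fun k => star (amplitude γ k) * amplitude δ k), Finset.sum_range]
  refine Finset.sum_congr rfl fun k _ => ?_
  have hk : (0 : ℝ) < N.choose k := by exact_mod_cast Nat.choose_pos (Nat.lt_succ_iff.1 k.2)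
  have hs : ((Real.sqrt (N.choose k) : ℝ) : ℂ) * ((Real.sqrt (N.choose k) : ℝ) : ℂ) =
      (N.choose k : ℂ) := by
    rw [← Complex.ofReal_mul, Real.mul_self_sqrt hk.le]
    simp
  have hne : ((Real.sqrt (N.choose k) : ℝ) : ℂ) ≠ 0 :=
    Complex.ofReal_ne_zero.2 (Real.sqrt_pos.2 hk).ne'
  simp only [amplitude, coeff, k.2, dif_pos, star_div₀, RCLike.star_def, Complex.conj_ofReal]
  rw [← hs]
  field_simp

theorem codeMatrix_conjTranspose_mul_self {α β : Fin (N + 1) → ℂ}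
    (horth : ∑ k, star (α k) * β k = 0) (hα : ∑ k, ‖α k‖ ^ 2 = 1) (hβ : ∑ k, ‖β k‖ ^ 2 = 1) :
    (codeMatrix α β)ᴴ * codeMatrix α β = 1 := by
  have hnorm : ∀ γ : Fin (N + 1) → ℂ, ∑ k, ‖γ k‖ ^ 2 = 1 → ∑ k, star (γ k) * γ k = 1 := by
    intro γ hγ
    have : ∀ k, star (γ k) * γ k = ((‖γ k‖ ^ 2 : ℝ) : ℂ) := fun k => by
      simp [Complex.conj_mul']
    simp only [this]
    rw [← Complex.ofReal_sum, hγ, Complex.ofReal_one]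
  have horth' : ∑ k, star (β k) * α k = 0 := by
    have := congrArg star horth
    simpa [mul_comm] using this
  ext i j
  rw [Matrix.mul_apply]
  simp only [conjTranspose_apply, codeMatrix, Matrix.of_apply, sum_star_amplitude_mul_amplitude]
  fin_cases i <;> fin_cases j
  · simpa using hnorm α hα
  · simpa using horth
  · simpa using horth'
  · simpa using hnorm β hβ

theorem range_codeMatrix (α β : Fin (N + 1) → ℂ) :
    LinearMap.range (codeMatrix α β).mulVecLin = piCode α β := by
  rw [range_mulVecLin, piCode]
  congr 1
  have h : (codeMatrix α β).col = ![codeword α, codeword β] := by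
    ext i w
    fin_cases i <;> simp [codeMatrix, codeword_apply, Matrix.col]
  rw [h]
  simp [Set.pair_comm]

theorem krausOp_mul_codeMatrix_gram {t s n : ℕ} (τ τ' : Fin t ⊕ Fin N ≃ Fin s ⊕ Fin n)
    (z z' : Bits s) (x x' : Bits t) (α β : Fin (N + 1) → ℂ) (i j : Fin 2) :
    ((krausOp τ z x * codeMatrix α β)ᴴ * (krausOp τ' z' x' * codeMatrix α β)) i j =
      overlap τ τ' z z' x x' (amplitudePairing (![α, β] i) (![α, β] j)) := by
  rw [Matrix.mul_apply, overlap]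
  refine Finset.sum_congr rfl fun y _ => ?_
  have h : ∀ (τ : Fin t ⊕ Fin N ≃ Fin s ⊕ Fin n) (z : Bits s) (x : Bits t) (i : Fin 2),
      (krausOp τ z x * codeMatrix α β) y i =
        if x = Sum.elim z y ∘ τ ∘ Sum.inl then
          amplitude (![α, β] i) (weight (Sum.elim z y ∘ τ ∘ Sum.inr)) else 0 :=
    fun τ z x i => krausOp_mulVec τ z x (fun w => codeMatrix α β w i) y
  rw [conjTranspose_apply, h, h, ite_and, amplitudePairing]
  split_ifs <;> simp

theorem overlap_sub {t s n : ℕ} (τ τ' : Fin t ⊕ Fin N ≃ Fin s ⊕ Fin n)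
    (z z' : Bits s) (x x' : Bits t) (H H' : ℕ → ℕ → ℂ) :
    overlap τ τ' z z' x x' (H - H') = overlap τ τ' z z' x x' H - overlap τ τ' z z' x x' H' := by
  simp only [overlap, ← Finset.sum_sub_distrib]
  refine Finset.sum_congr rfl fun y _ => ?_
  split_ifs <;> simp

theorem binomialSum_sub (H H' : ℕ → ℕ → ℂ) (r a b : ℕ) :
    binomialSum (H - H') r a b = binomialSum H r a b - binomialSum H' r a b := by
  simp only [binomialSum, ← Finset.sum_sub_distrib, Pi.sub_apply, mul_sub]

theorem binomialSum_succ (H : ℕ → ℕ → ℂ) (r a b : ℕ) :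
    binomialSum H (r + 1) a b = binomialSum H r a b + binomialSum H r (a + 1) (b + 1) := by
  have h1 : binomialSum H r a b = ∑ k ∈ Finset.range (r + 1 + 1),
      (r.choose k : ℂ) * H (a + k) (b + k) := by
    rw [Finset.sum_range_succ _ (r + 1), Nat.choose_succ_self]
    simp [binomialSum]
  rw [h1, Finset.sum_range_succ', binomialSum, Finset.sum_range_succ', binomialSum,
    add_right_comm, ← Finset.sum_add_distrib]
  congr 1
  · refine Finset.sum_congr rfl fun k _ => ?_
    rw [Nat.choose_succ_succ, add_assoc a, add_comm 1 k, add_assoc b, add_comm 1 k]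
    push_cast
    ring
  · simp

/-- By Pascal's rule the sum for `r + 1` at `(a, b)` is the sum of those for `r` at `(a, b)` and `(a
+ 1, b + 1)`; both points still satisfy the bounds for `r`. -/
theorem binomialSum_eq_zero_of_le (H : ℕ → ℕ → ℂ) {r₀ : ℕ}
    (h : ∀ a b, a + r₀ ≤ N → b + r₀ ≤ N → binomialSum H r₀ a b = 0) {r : ℕ} (hr : r₀ ≤ r) :
    ∀ a b, a + r ≤ N → b + r ≤ N → binomialSum H r a b = 0 := by
  induction r, hr using Nat.le_induction with
  | base => exact h
  | succ r _ ih =>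
    intro a b ha hb
    rw [binomialSum_succ, ih a b (by omega) (by omega), ih (a + 1) (b + 1) (by omega) (by omega),
      add_zero]

/-- The truncated difference `N - s - t` is the least admissible `r`; the extremal patterns give
vanishing there and Pascal's rule gives the rest. -/
theorem forall_overlap_eq_zero_iff {s t : ℕ} (hs : s ≤ N + t) (H : ℕ → ℕ → ℂ) :
    (∀ (a : InsertionStructure N t) (d : DeletionSet (N + t) s) (z : Bits s) (x : Bits t)
        (a' : InsertionStructure N t) (d' : DeletionSet (N + t) s) (z' : Bits s) (x' : Bits t),
        overlap (siteEquiv a d) (siteEquiv a' d') z z' x x' H = 0) ↔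
      ∀ r a b : ℕ, N ≤ r + s + t → r ≤ N + t - s → a + r ≤ N → b + r ≤ N →
        binomialSum H r a b = 0 := by
  constructor
  · intro h r a b hr _ ha hb
    refine binomialSum_eq_zero_of_le H (r₀ := N - s - t) (fun a b ha hb => ?_)
      (by omega) a b ha hb
    obtain ⟨A, A', d, z, z', x, x', hH⟩ :=
      exists_overlap_eq_binomialSum hs (a := a) (b := b) (by omega) (by omega)
    rw [← hH, h]
  · intro h a d z x a' d' z' x'
    exact overlap_eq_zero _ _ _ _ _ _ _ h

/-- The square root in the weight splits into the normalizations of the two amplitudes, and the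
terms with `k > r` vanish. -/
theorem sum_condWeight (γ δ : Fin (N + 1) → ℂ) {r : ℕ} (hr : r ≤ N) (a b : ℕ) :
    ∑ k ∈ Finset.range (N + 1), condWeight N r k a b *
        (star (coeff γ (k + a)) * coeff δ (k + b)) =
      binomialSum (amplitudePairing γ δ) r a b := by
  have hterm : ∀ k, condWeight N r k a b * (star (coeff γ (k + a)) * coeff δ (k + b)) =
      (r.choose k : ℂ) * amplitudePairing γ δ (a + k) (b + k) := by
    intro k
    simp only [condWeight, binom, amplitudePairing, amplitude, Nat.cast_nonneg, if_true,
      Int.toNat_natCast, star_div₀, RCLike.star_def, Complex.conj_ofReal,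
      Real.sqrt_mul (Nat.cast_nonneg _), Complex.ofReal_mul, add_comm a k, add_comm b k]
    simp only [div_eq_mul_inv, mul_inv]
    ring
  simp only [hterm]
  rw [binomialSum]
  refine (Finset.sum_subset (Finset.range_mono (by omega)) fun k _ hk => ?_).symm
  rw [Nat.choose_eq_zero_of_lt (by simpa using hk)]
  simp

theorem condWeight_of_neg {n : ℤ} (hn : n < 0) (k a b : ℕ) : condWeight N n k a b = 0 := by
  simp [condWeight, binom, hn.not_ge]

/-- For `r = N - t - s + 2l + j` the bound on `a` and `b` is exactly `N - r`, and a negative upper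
entry imposes nothing. -/
theorem forall_insdel_index_iff {N s t : ℕ} (hs : s ≤ N + t) (P : ℤ → ℕ → ℕ → Prop)
    (hP : ∀ n a b, n < 0 → P n a b) :
    (∀ l j a b : ℕ, l ≤ min s t → j ≤ t - l → a ≤ t + s - 2 * l - j → b ≤ t + s - 2 * l - j →
        P ((N : ℤ) - t - s + 2 * l + j) a b) ↔
      ∀ r a b : ℕ, N ≤ r + s + t → r ≤ N + t - s → a + r ≤ N → b + r ≤ N → P r a b := by
  constructor
  · intro h r a b h1 h2 h3 h4
    obtain ⟨l, j, hl, hj, hr, hm⟩ : ∃ l j : ℕ, l ≤ min s t ∧ j ≤ t - l ∧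
        (N : ℤ) - t - s + 2 * l + j = r ∧ t + s - 2 * l - j = N - r := by
      -- With `m = r + s + t - N` the equation is `2l + j = m`. Truncation gives `l = 0`, `j = m` if
      -- `m ≤ t`, and otherwise the least admissible `l = m - t`, with `j = t - l`.
      refine ⟨r + s + t - N - t, r + s + t - N - 2 * (r + s + t - N - t), ?_⟩
      omega
    rw [← hr]
    exact h l j a b hl hj (by omega) (by omega)
  · intro h l j a b hl hj ha hb
    rcases lt_or_ge ((N : ℤ) - t - s + 2 * l + j) 0 with hn | hn
    · exact hP _ _ _ hn
    · obtain ⟨r, hr⟩ := Int.eq_ofNat_of_zero_le hn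
      rw [hr]
      apply h <;> omega

theorem le_of_sum_eq_one {m s : ℕ} {q : DeletionSet m s → ℝ} (hq : ∑ d, q d = 1) : s ≤ m := by
  obtain ⟨d, -, -⟩ := Finset.exists_ne_zero_of_sum_ne_zero (hq ▸ one_ne_zero)
  rw [← d.2]
  simpa using Finset.card_le_univ d.1

end Amplitudes

end Insdel

end

/-! ### The equivalence -/

open Insdel Matrix in
theorem theorem2 (N s t : ℕ) (α β : Fin (N + 1) → ℂ)
    (horth : ∑ k, star (α k) * β k = 0)
    (hα : ∑ k, ‖α k‖ ^ 2 = 1) (hβ : ∑ k, ‖β k‖ ^ 2 = 1)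
    (μ : Measure (Insdel.InsertionCoeff t)) (hμ : μ.IsOpenPosMeasure)
    (p : Insdel.InsertionStructure N t → Insdel.InsertionCoeff t → ℝ)
    (hp_pos : ∀ a v, 0 < p a v) (hp_int : ∀ a, Integrable (p a) μ)
    (hp_sum : ∑ a, ∫ v, p a v ∂μ = 1)
    (q : Insdel.DeletionSet (N + t) s → ℝ)
    (hq_pos : ∀ d, 0 < q d) (hq_sum : ∑ d, q d = 1) :
    Insdel.IsCorrectable (Insdel.piCode α β)
        (fun ρ => Insdel.deletionChannel q (Insdel.insertionChannel μ p ρ)) ↔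
      ∀ l j a b : ℕ, l ≤ min s t → j ≤ t - l →
        a ≤ t + s - 2 * l - j → b ≤ t + s - 2 * l - j →
        (∑ k ∈ Finset.range (N + 1),
            Insdel.condWeight N ((N : ℤ) - t - s + 2 * l + j) k a b *
              (star (Insdel.coeff α (k + a)) * Insdel.coeff β (k + b)) = 0) ∧
        (∑ k ∈ Finset.range (N + 1),
            Insdel.condWeight N ((N : ℤ) - t - s + 2 * l + j) k a b *
              (star (Insdel.coeff α (k + a)) * Insdel.coeff α (k + b) -
                star (Insdel.coeff β (k + a)) * Insdel.coeff β (k + b)) = 0) := by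
  have hs : s ≤ N + t := le_of_sum_eq_one hq_sum
  rw [← range_codeMatrix, isCorrectable_iff_scalar_gram (codeMatrix α β)
    (codeMatrix_conjTranspose_mul_self horth hα hβ) μ p hp_pos hp_int hp_sum q hq_pos hq_sum]
  rw [forall_insdel_index_iff hs (fun n a b =>
    (∑ k ∈ Finset.range (N + 1), condWeight N n k a b *
      (star (coeff α (k + a)) * coeff β (k + b)) = 0) ∧
    (∑ k ∈ Finset.range (N + 1), condWeight N n k a b *
      (star (coeff α (k + a)) * coeff α (k + b) - star (coeff β (k + a)) * coeff β (k + b)) = 0))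
    (fun n a b hn => by simp [condWeight_of_neg hn])]
  have hkey : ∀ r a b : ℕ, a + r ≤ N →
      ((∑ k ∈ Finset.range (N + 1), condWeight N r k a b *
        (star (coeff α (k + a)) * coeff β (k + b)) = 0) ∧
      (∑ k ∈ Finset.range (N + 1), condWeight N r k a b *
        (star (coeff α (k + a)) * coeff α (k + b) - star (coeff β (k + a)) * coeff β (k + b)) = 0)
        ↔ binomialSum (amplitudePairing α β) r a b = 0 ∧
          binomialSum (amplitudePairing α α - amplitudePairing β β) r a b = 0) := by
    intro r a b har
    simp only [mul_sub, Finset.sum_sub_distrib, binomialSum_sub]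
    rw [sum_condWeight α β (by omega), sum_condWeight α α (by omega),
      sum_condWeight β β (by omega)]
  -- A two-by-two Gram matrix is scalar when its off-diagonal entries vanish (C5) and its diagonal
  -- entries agree (C6).
  have h1 := forall_overlap_eq_zero_iff hs (amplitudePairing α β)
  have h2 := forall_overlap_eq_zero_iff hs (amplitudePairing α α - amplitudePairing β β)
  have hgram : ∀ (a : InsertionStructure N t) (d : DeletionSet (N + t) s) (z : Bits s)
      (x : Bits t) (a' : InsertionStructure N t) (d' : DeletionSet (N + t) s) (z' : Bits s)
      (x' : Bits t) (i j : Fin 2), _ := fun a d z x a' d' z' x' i j =>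
    krausOp_mul_codeMatrix_gram (siteEquiv a d) (siteEquiv a' d') z z' x x' α β i j
  constructor
  · intro h r a b hr1 hr2 ha hb
    rw [hkey r a b ha]
    refine ⟨h1.1 (fun a d z x a' d' z' x' => ?_) r a b hr1 hr2 ha hb,
      h2.1 (fun a d z x a' d' z' x' => ?_) r a b hr1 hr2 ha hb⟩
    · obtain ⟨l, hl⟩ := h a d z x a' d' z' x'
      have := hgram a d z x a' d' z' x' 0 1
      rw [hl] at this
      simpa using this.symm
    · obtain ⟨l, hl⟩ := h a d z x a' d' z' x'
      have e0 := hgram a d z x a' d' z' x' 0 0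
      have e1 := hgram a d z x a' d' z' x' 1 1
      rw [hl] at e0 e1
      simp only [Matrix.smul_apply, Matrix.one_apply_eq] at e0 e1
      rw [overlap_sub]
      exact sub_eq_zero.2 (e0.symm.trans e1)
  · intro h
    have g1 := h1.2 fun r a b hr1 hr2 ha hb => ((hkey r a b ha).1 (h r a b hr1 hr2 ha hb)).1
    have g2 := h2.2 fun r a b hr1 hr2 ha hb => ((hkey r a b ha).1 (h r a b hr1 hr2 ha hb)).2
    intro a d z x a' d' z' x'
    refine ⟨overlap (siteEquiv a d) (siteEquiv a' d') z z' x x' (amplitudePairing α α), ?_⟩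
    have e01 := (hgram a d z x a' d' z' x' 0 1).trans (g1 a d z x a' d' z' x')
    -- The entry `(1, 0)` is the conjugate of the entry `(0, 1)` with the two operators
    -- interchanged, so (C5) covers it too.
    have e10 := congrArg star ((hgram a' d' z' x' a d z x 0 1).trans (g1 a' d' z' x' a d z x))
    rw [← conjTranspose_apply, conjTranspose_mul, conjTranspose_conjTranspose, star_zero] at e10
    have e00 := hgram a d z x a' d' z' x' 0 0
    have e11 := hgram a d z x a' d' z' x' 1 1
    have e := g2 a d z x a' d' z' x'
    rw [overlap_sub, sub_eq_zero] at e
    ext i j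
    fin_cases i <;> fin_cases j
    · simpa using e00
    · simpa using e01
    · simpa using e10
    · simpa [e] using e11
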